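/- Let $n\in\{2,3\}$, let $\Omega\subset\mathbb R^n$ be a bounded open set (in particular, any bounded Lipschitz domain), let $f,y_d\in L^2(\Omega)$ and $\mu,\nu>0$. Let $a_{ij}=a_{ji}\in L^\infty(\Omega)$ ($1\le i,j\le n$) and $0\le a_0\in L^\infty(\Omega)$, and assume that there is $C_A>0$ with $\sum_{i,j}a_{ij}(t)\xi_i\xi_j\ge C_A|\xi|^2$ for all $\xi\in\mathbb R^n$ and almost every $t\in\Omega$. Let $A\colon H^1_0(\Omega)\to H^{-1}(\Omega)$ be given by $\langle Ay,v\rangle=\int_\Omega\big(\sum_{i,j}a_{ij}\,\partial_iy\,\partial_jv+a_0yv\big)$. Let $\varphi\in C^2(\mathbb R)$ be monotonically increasing with $\varphi''$ locally Lipschitz continuous. For $\varepsilon\ge0$ and $t\in\mathbb R$ put $$P_\varepsilon(t)=\tfrac12\Big(\sqrt{(t+1)^2+\varepsilon}-\sqrt{(t-1)^2+\varepsilon}\Big).$$ Let $V=H^1_0(\Omega)^2$ and $V'=H^{-1}(\Omega)^2$, where $H^1_0(\Omega)$ carries the inner product $\langle u,v\rangle=\int_\Omega\nabla u\cdot\nabla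 v+uv$ and elements of $L^2(\Omega)$ are regarded as elements of $H^{-1}(\Omega)$ through the $L^2$ pairing. For $x=(y,p)\in V$ with $y,p\in L^\infty(\Omega)$ define $$F(x,\varepsilon)=\begin{bmatrix}Ay+\varphi(y)-f+\frac1\nu\big(p+\mu P_\varepsilon(-\frac p\mu)\big)\\ Ap+\varphi'(y)p-y+y_d\end{bmatrix}\in V',$$ and, for $\varepsilon>0$, its derivative with respect to $x$, $$\frac{\partial}{\partial x}F(x,\varepsilon)=\begin{bmatrix}A+\varphi'(y)&\frac1\nu\big(\mathbb I-P_\varepsilon'(-\frac p\mu)\big)\\ \varphi''(y)p-\mathbb I&A+\varphi'(y)\end{bmatrix}\in\mathcal L(V,V').$$ For every $\varepsilon>0$ let $x(\varepsilon)=(y(\varepsilon),p(\varepsilon))$ with $y(\varepsilon),p(\varepsilon)\in H^1_0(\Omega)\cap L^\infty(\Omega)$ be a solution of $F(x(\varepsilon),\varepsilon)=0$ in $V'$. Assume that $\frac{\partial}{\partial x}F(x(\varepsilon),\varepsilon)\colon V\to V'$ is continuously invertible for all $\varepsilon>0$ and that the norm of its inverse is bounded by a constant independent of $\varepsilon$.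 If $x(\varepsilon)$ converges in $V$ to some $x\in V$ as $\varepsilon\to0$, then $$\|x-x(\varepsilon)\|_{H^1_0(\Omega)^2}=\mathcal O(\sqrt\varepsilon)\qquad\text{as }\varepsilon\to0.$$ -/

import Mathlib

open MeasureTheory Filter Topology Asymptotics
open scoped ENNReal ContDiff

noncomputable section

namespace EllipticControl

/-- Lebesgue measure on a set `Ω ⊆ ℝⁿ`. -/
abbrev dom {n : ℕ} (Ω : Set (EuclideanSpace ℝ (Fin n))) : Measure (EuclideanSpace ℝ (Fin n)) :=
  volume.restrict Ω

/-! ### The Sobolev space `H¹₀(Ω)` and its dual -/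

/-- The pairs `(ψ, ∇ψ)` in `L²(Ω) × L²(Ω; ℝⁿ)`, where `ψ` is a smooth function with compact support
contained in `Ω`. The ambient space carries the Hilbert norm `(‖u‖² + ‖w‖²)^(1/2)`. -/
def testGraph {n : ℕ} (Ω : Set (EuclideanSpace ℝ (Fin n))) :
    Submodule ℝ (WithLp 2 (Lp ℝ 2 (dom Ω) × Lp (EuclideanSpace ℝ (Fin n)) 2 (dom Ω))) where
  carrier := {w | ∃ ψ : EuclideanSpace ℝ (Fin n) → ℝ,
    ContDiff ℝ ∞ ψ ∧ HasCompactSupport ψ ∧ tsupport ψ ⊆ Ω ∧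
      w.fst =ᵐ[dom Ω] ψ ∧ w.snd =ᵐ[dom Ω] gradient ψ}
  zero_mem' := by
    refine ⟨0, contDiff_const, HasCompactSupport.zero, by simp [tsupport], ?_, ?_⟩
    · exact Lp.coeFn_zero _ _ _
    · have h : gradient (0 : EuclideanSpace ℝ (Fin n) → ℝ) = 0 := by
        funext x; simp [gradient]
      rw [h]
      exact Lp.coeFn_zero _ _ _
  add_mem' := by
    rintro w₁ w₂ ⟨ψ₁, h₁, c₁, s₁, e₁, g₁⟩ ⟨ψ₂, h₂, c₂, s₂, e₂, g₂⟩
    refine ⟨ψ₁ + ψ₂, h₁.add h₂, c₁.add c₂,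
      (tsupport_add ψ₁ ψ₂).trans (Set.union_subset s₁ s₂), ?_, ?_⟩
    · exact (Lp.coeFn_add w₁.fst w₂.fst).trans (e₁.add e₂)
    · have h : gradient (ψ₁ + ψ₂) = gradient ψ₁ + gradient ψ₂ := by
        funext x
        have d₁ := (h₁.differentiable (by simp)) x
        have d₂ := (h₂.differentiable (by simp)) x
        simp [gradient, fderiv_add d₁ d₂]
      rw [h]
      exact (Lp.coeFn_add w₁.snd w₂.snd).trans (g₁.add g₂)
  smul_mem' := by
    rintro c w ⟨ψ, h, cs, s, e, g⟩
    refine ⟨c • ψ, contDiff_const.smul h, cs.smul_left (f := fun _ => c),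
      (closure_mono (Function.support_const_smul_subset c ψ)).trans s, ?_, ?_⟩
    · exact (Lp.coeFn_smul c w.fst).trans (e.const_smul c)
    · have hg : gradient (c • ψ) = c • gradient ψ := by
        funext x
        have d := (h.differentiable (by simp)) x
        simp [gradient, fderiv_const_smul d c]
      rw [hg]
      exact (Lp.coeFn_smul c w.snd).trans (g.const_smul c)

/-- `H¹₀(Ω)`: the closure of the test functions in `H¹(Ω)`. An element is stored as the pair
`(u, ∇u)` of the function and its weak gradient, and the inner product is
`⟨u, v⟩ = ∫ u v + ∇u · ∇v`. -/
def H10 {n : ℕ} (Ω : Set (EuclideanSpace ℝ (Fin n))) : Type :=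
  (testGraph Ω).topologicalClosure

instance H10.instNormedAddCommGroup {n : ℕ} (Ω : Set (EuclideanSpace ℝ (Fin n))) :
    NormedAddCommGroup (H10 Ω) :=
  inferInstanceAs (NormedAddCommGroup (testGraph Ω).topologicalClosure)

instance H10.instInnerProductSpace {n : ℕ} (Ω : Set (EuclideanSpace ℝ (Fin n))) :
    InnerProductSpace ℝ (H10 Ω) :=
  inferInstanceAs (InnerProductSpace ℝ (testGraph Ω).topologicalClosure)

instance H10.instCompleteSpace {n : ℕ} (Ω : Set (EuclideanSpace ℝ (Fin n))) :
    CompleteSpace (H10 Ω) :=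
  inferInstanceAs (CompleteSpace (testGraph Ω).topologicalClosure)

/-- An element of `H¹₀(Ω)` as the pair `(u, ∇u)` in `L²(Ω) × L²(Ω; ℝⁿ)`. -/
def toPair {n : ℕ} (Ω : Set (EuclideanSpace ℝ (Fin n))) :
    H10 Ω →L[ℝ] WithLp 2 (Lp ℝ 2 (dom Ω) × Lp (EuclideanSpace ℝ (Fin n)) 2 (dom Ω)) :=
  (testGraph Ω).topologicalClosure.subtypeL

/-- `H⁻¹(Ω)`, the topological dual of `H¹₀(Ω)`. -/
abbrev Hm1 {n : ℕ} (Ω : Set (EuclideanSpace ℝ (Fin n))) : Type :=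
  H10 Ω →L[ℝ] ℝ

/-- The embedding `H¹₀(Ω) → L²(Ω)`. -/
def embed {n : ℕ} (Ω : Set (EuclideanSpace ℝ (Fin n))) : H10 Ω →L[ℝ] Lp ℝ 2 (dom Ω) :=
  (WithLp.fstL 2 ℝ (Lp ℝ 2 (dom Ω)) (Lp (EuclideanSpace ℝ (Fin n)) 2 (dom Ω))).comp
    (toPair Ω)

/-- The weak partial derivative `∂ᵢ : H¹₀(Ω) → L²(Ω)`. -/
def partialD {n : ℕ} (Ω : Set (EuclideanSpace ℝ (Fin n))) (i : Fin n) :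
    H10 Ω →L[ℝ] Lp ℝ 2 (dom Ω) :=
  ((EuclideanSpace.proj i : EuclideanSpace ℝ (Fin n) →L[ℝ] ℝ).compLpL 2 (dom Ω)).comp
    ((WithLp.sndL 2 ℝ (Lp ℝ 2 (dom Ω)) (Lp (EuclideanSpace ℝ (Fin n)) 2 (dom Ω))).comp
      (toPair Ω))

/-- For `S : H¹₀(Ω) → L²(Ω)`, the map `L²(Ω) → H⁻¹(Ω)` sending `g` to `v ↦ ∫ g · (S v)`. -/
def dualOf {n : ℕ} {Ω : Set (EuclideanSpace ℝ (Fin n))} (S : H10 Ω →L[ℝ] Lp ℝ 2 (dom Ω)) :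
    Lp ℝ 2 (dom Ω) →L[ℝ] Hm1 Ω :=
  (((ContinuousLinearMap.mul ℝ ℝ).lpPairing (dom Ω) 2 2).flip.comp S).flip

/-- The embedding `L²(Ω) → H⁻¹(Ω)`, `g ↦ (v ↦ ∫ g v)`. -/
def gelfand {n : ℕ} (Ω : Set (EuclideanSpace ℝ (Fin n))) : Lp ℝ 2 (dom Ω) →L[ℝ] Hm1 Ω :=
  dualOf (embed Ω)

/-- Multiplication by `b ∈ L^∞(Ω)` as an operator on `L²(Ω)`. -/
def mulL {n : ℕ} {Ω : Set (EuclideanSpace ℝ (Fin n))} (b : Lp ℝ ∞ (dom Ω)) :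
    Lp ℝ 2 (dom Ω) →L[ℝ] Lp ℝ 2 (dom Ω) :=
  (ContinuousLinearMap.mul ℝ ℝ).holderL (dom Ω) ∞ 2 2 b

/-- Multiplication by `b ∈ L^∞(Ω)` as an operator `H¹₀(Ω) → H⁻¹(Ω)`, `u ↦ (v ↦ ∫ b u v)`. -/
def mulOp {n : ℕ} {Ω : Set (EuclideanSpace ℝ (Fin n))} (b : Lp ℝ ∞ (dom Ω)) : H10 Ω →L[ℝ] Hm1 Ω :=
  (gelfand Ω).comp ((mulL b).comp (embed Ω))

/-- A continuous function of an essentially bounded function is essentially bounded. -/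
theorem memLp_top_comp {n : ℕ} {Ω : Set (EuclideanSpace ℝ (Fin n))} {g : ℝ → ℝ}
    (hg : Continuous g) {u : EuclideanSpace ℝ (Fin n) → ℝ} (hu : MemLp u ∞ (dom Ω)) :
    MemLp (fun x => g (u x)) ∞ (dom Ω) := by
  obtain ⟨C, hC⟩ := (isCompact_Icc (a := -(eLpNorm u ∞ (dom Ω)).toReal)
    (b := (eLpNorm u ∞ (dom Ω)).toReal)).exists_bound_of_continuousOn hg.continuousOn
  refine memLp_top_of_bound (hg.comp_aestronglyMeasurable hu.1) C ?_
  have h := ae_le_eLpNormEssSup (f := u) (μ := dom Ω)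
  filter_upwards [h] with x hx
  have hx' : ‖u x‖ ≤ (eLpNorm u ∞ (dom Ω)).toReal := by
    have := ENNReal.toReal_mono hu.2.ne (by simpa [eLpNorm_exponent_top] using hx)
    simpa using this
  exact hC _ (abs_le.1 hx')

/-! ### The smoothed projection -/

/-- `P_ε(t) = (√((t+1)² + ε) - √((t-1)² + ε)) / 2`. -/
def smoothProj (ε t : ℝ) : ℝ :=
  (Real.sqrt ((t + 1) ^ 2 + ε) - Real.sqrt ((t - 1) ^ 2 + ε)) / 2

theorem continuous_smoothProj (ε : ℝ) : Continuous (smoothProj ε) := by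
  unfold smoothProj
  fun_prop

theorem contDiff_smoothProj {ε : ℝ} (hε : 0 < ε) : ContDiff ℝ 1 (smoothProj ε) := by
  unfold smoothProj
  refine ContDiff.div_const (ContDiff.sub ?_ ?_) 2
  · exact ContDiff.sqrt (by fun_prop) fun x => by positivity
  · exact ContDiff.sqrt (by fun_prop) fun x => by positivity

theorem continuous_deriv_smoothProj {ε : ℝ} (hε : 0 < ε) : Continuous (deriv (smoothProj ε)) :=
  (contDiff_smoothProj hε).continuous_deriv le_rfl

/-! ### The control problem and its smoothed optimality system -/

/-- The data of the control problem
`min ½‖y - y_d‖² + (ν/2)‖u‖² + μ‖u‖_{L¹}` subject to `A y + φ(y) = f + u`, with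
`A y = -∑ ∂ⱼ(aᵢⱼ ∂ᵢ y) + a₀ y`, together with the standing assumptions on them. -/
structure Problem (n : ℕ) where
  Ω : Set (EuclideanSpace ℝ (Fin n))
  isOpen : IsOpen Ω
  isBounded : Bornology.IsBounded Ω
  f : Lp ℝ 2 (dom Ω)
  yd : Lp ℝ 2 (dom Ω)
  mu : ℝ
  nu : ℝ
  mu_pos : 0 < mu
  nu_pos : 0 < nu
  a : Fin n → Fin n → Lp ℝ ∞ (dom Ω)
  a₀ : Lp ℝ ∞ (dom Ω)
  a_symm : ∀ i j, a i j = a j i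
  a₀_nonneg : ∀ᵐ x ∂(dom Ω), 0 ≤ a₀ x
  elliptic : ∃ C : ℝ, 0 < C ∧ ∀ᵐ x ∂(dom Ω), ∀ ξ : EuclideanSpace ℝ (Fin n),
    C * ‖ξ‖ ^ 2 ≤ ∑ i, ∑ j, a i j x * ξ i * ξ j
  φ : ℝ → ℝ
  φ_contDiff : ContDiff ℝ 2 φ
  φ_mono : Monotone φ
  φ_lip : LocallyLipschitz (deriv (deriv φ))

namespace Problem

variable {n : ℕ} (P : Problem n)

theorem continuous_phi : Continuous P.φ := P.φ_contDiff.continuous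

theorem continuous_deriv_phi : Continuous (deriv P.φ) :=
  P.φ_contDiff.continuous_deriv (by norm_num)

theorem continuous_deriv2_phi : Continuous (deriv (deriv P.φ)) := P.φ_lip.continuous

instance isFiniteMeasure_dom : IsFiniteMeasure (dom P.Ω) :=
  ⟨by simpa using P.isBounded.measure_lt_top⟩

/-- The space `V = H¹₀(Ω)²` of pairs `x = (y, p)`, with its Hilbert norm. -/
abbrev V : Type := WithLp 2 (H10 P.Ω × H10 P.Ω)

/-- The space `V' = H⁻¹(Ω)²`. -/
abbrev V' : Type := WithLp 2 (Hm1 P.Ω × Hm1 P.Ω)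

/-- The elliptic operator `A : H¹₀(Ω) → H⁻¹(Ω)`,
`⟨A y, v⟩ = ∫ ∑ aᵢⱼ ∂ᵢy ∂ⱼv + a₀ y v`. -/
def A : H10 P.Ω →L[ℝ] Hm1 P.Ω :=
  (∑ i, ∑ j, (dualOf (partialD P.Ω j)).comp ((mulL (P.a i j)).comp (partialD P.Ω i)))
    + mulOp P.a₀

/-- `u ∈ H¹₀(Ω) ∩ L^∞(Ω)`. -/
def IsBdd (u : H10 P.Ω) : Prop := MemLp (embed P.Ω u) ∞ (dom P.Ω)

/-- The pairs `x = (y, p)` with `y, p ∈ H¹₀(Ω) ∩ L^∞(Ω)`. -/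
def Bdd : Type := {x : P.V // P.IsBdd x.fst ∧ P.IsBdd x.snd}

variable {P}

namespace Bdd

/-- The first component, the state. -/
def y (x : P.Bdd) : H10 P.Ω := x.1.fst

/-- The second component, the adjoint state. -/
def p (x : P.Bdd) : H10 P.Ω := x.1.snd

theorem y_memLp (x : P.Bdd) : MemLp (embed P.Ω x.y) ∞ (dom P.Ω) := x.2.1

theorem p_memLp (x : P.Bdd) : MemLp (embed P.Ω x.p) ∞ (dom P.Ω) := x.2.2

/-- `φ(y) ∈ L^∞(Ω)`. -/
def phiY (x : P.Bdd) : Lp ℝ ∞ (dom P.Ω) :=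
  (memLp_top_comp P.continuous_phi x.y_memLp).toLp (fun t => P.φ (embed P.Ω x.y t))

/-- `φ'(y) ∈ L^∞(Ω)`. -/
def dphiY (x : P.Bdd) : Lp ℝ ∞ (dom P.Ω) :=
  (memLp_top_comp P.continuous_deriv_phi x.y_memLp).toLp (fun t => deriv P.φ (embed P.Ω x.y t))

/-- `φ''(y) p ∈ L^∞(Ω)`. -/
def ddphiYP (x : P.Bdd) : Lp ℝ ∞ (dom P.Ω) :=
  ((x.p_memLp).mul (memLp_top_comp P.continuous_deriv2_phi x.y_memLp)).toLp
    ((fun t => deriv (deriv P.φ) (embed P.Ω x.y t)) * (fun t => embed P.Ω x.p t))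

theorem negp_memLp (x : P.Bdd) :
    MemLp (fun t => -(embed P.Ω x.p t) / P.mu) ∞ (dom P.Ω) :=
  memLp_top_comp (g := fun s => -s / P.mu) (by fun_prop) x.p_memLp

/-- `P_ε(-p/μ) ∈ L^∞(Ω)`. -/
def projP (x : P.Bdd) (ε : ℝ) : Lp ℝ ∞ (dom P.Ω) :=
  (memLp_top_comp (continuous_smoothProj ε) x.negp_memLp).toLp
    (fun t => smoothProj ε (-(embed P.Ω x.p t) / P.mu))

/-- `P_ε'(-p/μ) ∈ L^∞(Ω)` for `ε > 0`. -/
def dprojP (x : P.Bdd) {ε : ℝ} (hε : 0 < ε) : Lp ℝ ∞ (dom P.Ω) :=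
  (memLp_top_comp (continuous_deriv_smoothProj hε) x.negp_memLp).toLp
    (fun t => deriv (smoothProj ε) (-(embed P.Ω x.p t) / P.mu))

end Bdd

variable (P)

/-- The inclusion `L^∞(Ω) ⊆ L²(Ω)`. -/
def toL2 (b : Lp ℝ ∞ (dom P.Ω)) : Lp ℝ 2 (dom P.Ω) :=
  ((Lp.memLp b).mono_exponent le_top).toLp b

/-- The map `F(x, ε)`, with values in `V'`, of the (for `ε > 0` smoothed) optimality system:
its components are `A y + φ(y) - f + (1/ν)(p + μ P_ε(-p/μ))` and `A p + φ'(y) p - y + y_d`. -/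
def F (x : P.Bdd) (ε : ℝ) : P.V' :=
  WithLp.toLp 2
    (P.A x.y + gelfand P.Ω (P.toL2 x.phiY - P.f
        + (1 / P.nu) • (embed P.Ω x.p + P.mu • P.toL2 (x.projP ε))),
     P.A x.p + gelfand P.Ω (mulL x.dphiY (embed P.Ω x.p) - embed P.Ω x.y + P.yd))

/-- The identification `H¹₀(Ω) → H⁻¹(Ω)` through `L²(Ω)`. -/
def idOp : H10 P.Ω →L[ℝ] Hm1 P.Ω := (gelfand P.Ω).comp (embed P.Ω)

/-- The derivative `∂F/∂x (x, ε) : V → V'` for `ε > 0`, the block operator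
`[[A + φ'(y), (1/ν)(I - P_ε'(-p/μ))], [φ''(y)p - I, A + φ'(y)]]`. -/
def dF (x : P.Bdd) {ε : ℝ} (hε : 0 < ε) : P.V →L[ℝ] P.V' :=
  ((WithLp.prodContinuousLinearEquiv 2 ℝ (Hm1 P.Ω) (Hm1 P.Ω)).symm :
      Hm1 P.Ω × Hm1 P.Ω →L[ℝ] P.V').comp
    (((P.A + mulOp x.dphiY).comp (WithLp.fstL 2 ℝ (H10 P.Ω) (H10 P.Ω))
        + ((1 / P.nu) • (P.idOp - mulOp (x.dprojP hε))).comp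
            (WithLp.sndL 2 ℝ (H10 P.Ω) (H10 P.Ω))).prod
      ((mulOp x.ddphiYP - P.idOp).comp (WithLp.fstL 2 ℝ (H10 P.Ω) (H10 P.Ω))
        + (P.A + mulOp x.dphiY).comp (WithLp.sndL 2 ℝ (H10 P.Ω) (H10 P.Ω))))

end Problem

end EllipticControl

end

/-! The argument is that of Newton's method. Let d be the distance from x(ε) to the limit x. Since
F(x(ε), ε) and F(x, 0) both vanish, the derivative of F at (x(ε), ε), applied to x - x(ε), is minus
the Newton remainder (`dF_sub_eq`). If the remainder is at most K₀√ε + ηd + Kd² with η as small as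
desired (`exists_norm_dF_sub_le`), the uniformly bounded inverse gives the same bound for d up to a
constant, and the last two terms are absorbed for small ε because d → 0.

In the remainder the linear operator A drops out. The terms with φ and φ' are quadratic once y and p
are bounded uniformly in ε, and squares of H¹₀ functions are controlled in L² through the embedding
into L⁶.

The delicate term is P_ε, whose limit P_0 has kinks at ±1. Pointwise, its remainder is O(√ε), plus a
linear term where the limit argument -p/μ is within δ of a kink without lying on it, plus a
quadratic term with constant of order 1/δ (`abs_smoothProj_remainder_le`). On a kink only √ε occurs,
so nothing is needed about the measure of the set where |p| = μ. The exceptional set depends on the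
limit alone and its measure tends to 0 with δ (`exists_measure_small_ne_zero`); Hölder between L²
and L⁶ turns this into the small factor η.

The uniform L^∞ bounds come from Stampacchia's method (`exists_uniform_bound`): monotonicity gives
φ(y) - φ(0) and φ'(y)p the signs of y and p, so these terms can be discarded, and |P_ε| ≤ 1 leaves
sources bounded in L². The bounds pass to the limit, so F(x, 0) is defined, and it vanishes by
continuity (`exists_norm_F_sub_le`). -/

noncomputable section

open scoped NNReal

namespace EllipticControl

/-! ### The space H¹₀(Ω) and its embedding into L⁶ -/

section Sobolev

variable {n : ℕ} {Ω : Set (EuclideanSpace ℝ (Fin n))}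

/-- The weak gradient of an element of `H¹₀(Ω)`. -/
def grad (u : H10 Ω) : Lp (EuclideanSpace ℝ (Fin n)) 2 (dom Ω) := (toPair Ω u).snd

theorem norm_sq_eq (u : H10 Ω) : ‖u‖ ^ 2 = ‖embed Ω u‖ ^ 2 + ‖grad u‖ ^ 2 := by
  have h : ‖u‖ = ‖toPair Ω u‖ := rfl
  rw [h, WithLp.prod_norm_sq_eq_of_L2]; rfl

theorem norm_embed_le (u : H10 Ω) : ‖embed Ω u‖ ≤ ‖u‖ :=
  abs_le_of_sq_le_sq' (by nlinarith [norm_sq_eq u, sq_nonneg ‖grad u‖]) (norm_nonneg _) |>.2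

theorem norm_grad_le (u : H10 Ω) : ‖grad u‖ ≤ ‖u‖ :=
  abs_le_of_sq_le_sq' (by nlinarith [norm_sq_eq u, sq_nonneg ‖embed Ω u‖]) (norm_nonneg _) |>.2

theorem partialD_apply_ae (i : Fin n) (u : H10 Ω) :
    partialD Ω i u =ᵐ[dom Ω] fun x => grad u x i := by
  have h := ContinuousLinearMap.coeFn_compLpL (p := 2) (μ := dom Ω)
    (EuclideanSpace.proj i : EuclideanSpace ℝ (Fin n) →L[ℝ] ℝ) (grad u)
  exact h

theorem dualOf_apply (S : H10 Ω →L[ℝ] Lp ℝ 2 (dom Ω)) (g : Lp ℝ 2 (dom Ω)) (v : H10 Ω) :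
    dualOf S g v = ∫ x, g x * S v x ∂(dom Ω) := by
  simp [dualOf, ContinuousLinearMap.lpPairing_eq_integral]

theorem gelfand_apply (g : Lp ℝ 2 (dom Ω)) (v : H10 Ω) :
    gelfand Ω g v = ∫ x, g x * embed Ω v x ∂(dom Ω) := dualOf_apply _ _ _

theorem mulL_ae (b : Lp ℝ ∞ (dom Ω)) (g : Lp ℝ 2 (dom Ω)) :
    mulL b g =ᵐ[dom Ω] fun x => b x * g x :=
  ContinuousLinearMap.coeFn_holder (r := 2) (ContinuousLinearMap.mul ℝ ℝ) b g

/-- Every element of `H¹₀(Ω)` is a limit of test functions. -/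
theorem exists_test_seq (u : H10 Ω) : ∃ (w : ℕ → H10 Ω) (ψ : ℕ → EuclideanSpace ℝ (Fin n) → ℝ),
    Tendsto w atTop (𝓝 u) ∧ ∀ k, ContDiff ℝ ∞ (ψ k) ∧ HasCompactSupport (ψ k) ∧
      tsupport (ψ k) ⊆ Ω ∧ embed Ω (w k) =ᵐ[dom Ω] ψ k ∧
      grad (w k) =ᵐ[dom Ω] gradient (ψ k) := by
  have hu : toPair Ω u ∈ closure (testGraph Ω : Set _) := Subtype.coe_prop u
  obtain ⟨s, hs, hlim⟩ := mem_closure_iff_seq_limit.1 hu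
  choose ψ h using hs
  refine ⟨fun k => ⟨s k, subset_closure ⟨ψ k, h k⟩⟩, ψ, ?_, h⟩
  exact tendsto_subtype_rng.2 hlim

theorem exists_of_mem_closure
    {w : WithLp 2 (Lp ℝ 2 (dom Ω) × Lp (EuclideanSpace ℝ (Fin n)) 2 (dom Ω))}
    (hw : w ∈ closure (testGraph Ω : Set _)) : ∃ v : H10 Ω, embed Ω v = w.fst ∧ grad v = w.snd :=
  ⟨⟨w, hw⟩, rfl, rfl⟩

theorem norm_gradient (ψ : EuclideanSpace ℝ (Fin n) → ℝ) (x : EuclideanSpace ℝ (Fin n)) :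
    ‖gradient ψ x‖ = ‖fderiv ℝ ψ x‖ := by
  simp [gradient]

theorem measure_dom_lt_top (hΩ : Bornology.IsBounded Ω) : dom Ω Set.univ < ⊤ := by
  simpa using hΩ.measure_lt_top

/-- The Sobolev inequality `‖ψ‖_{L⁶} ≤ S ‖∇ψ‖_{L²}` for test functions in dimensions 2 and 3. -/
theorem exists_sobolev_test (hn : n = 2 ∨ n = 3) (hΩ : IsOpen Ω) (hb : Bornology.IsBounded Ω) :
    ∃ S : ℝ≥0, ∀ ψ : EuclideanSpace ℝ (Fin n) → ℝ, ContDiff ℝ ∞ ψ → tsupport ψ ⊆ Ω →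
      eLpNorm ψ 6 (dom Ω) ≤ S * eLpNorm (gradient ψ) 2 (dom Ω) := by
  have : IsFiniteMeasure (dom Ω) := ⟨measure_dom_lt_top hb⟩
  -- The exponent p has Sobolev conjugate 6: it is 3/2 in dimension 2 and 2 in dimension 3. In
  -- dimension 2 it must stay below 2, and finiteness of the measure of Ω then raises the exponent
  -- of the gradient to 2.
  obtain ⟨p, hp1, hpn, hp6, hp2⟩ : ∃ p : ℝ≥0, 1 ≤ p ∧ p < n ∧
      (p : ℝ)⁻¹ - (n : ℝ)⁻¹ ≤ ((6 : ℝ≥0) : ℝ)⁻¹ ∧ p ≤ 2 := by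
    rcases hn with rfl | rfl
    · refine ⟨3 / 2, ?_, ?_, ?_, ?_⟩
      · rw [← NNReal.coe_le_coe]; norm_num
      · rw [← NNReal.coe_lt_coe]; norm_num
      · norm_num
      · rw [← NNReal.coe_le_coe]; norm_num
    · exact ⟨2, by norm_num, by norm_num, by norm_num, le_rfl⟩
  set C := eLpNormLESNormFDerivOfLeConst ℝ (volume : Measure (EuclideanSpace ℝ (Fin n))) Ω p 6
  have hfin : dom Ω Set.univ ^ (1 / (p : ℝ≥0∞).toReal - 1 / (2 : ℝ≥0∞).toReal) ≠ ⊤ := by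
    refine (ENNReal.rpow_lt_top_of_nonneg ?_ (measure_ne_top _ _)).ne
    rw [sub_nonneg]
    have hp0 : (0 : ℝ) < p := lt_of_lt_of_le one_pos (by exact_mod_cast hp1)
    have : (p : ℝ) ≤ 2 := by exact_mod_cast hp2
    simpa using one_div_le_one_div_of_le hp0 this
  refine ⟨C * (dom Ω Set.univ ^ (1 / (p : ℝ≥0∞).toReal - 1 / (2 : ℝ≥0∞).toReal)).toNNReal, ?_⟩
  intro ψ hψ hs
  have hsupp : Function.support ψ ⊆ Ω := (subset_tsupport ψ).trans hs
  have hG : ContDiff ℝ 1 ψ := hψ.of_le (by exact_mod_cast le_top)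
  have key := eLpNorm_le_eLpNorm_fderiv_of_le (F := ℝ) (q := 6)
    (volume : Measure (EuclideanSpace ℝ (Fin n))) hG
    hsupp hp1 (by simpa using hpn) (by simpa using hp6) hb
  have hfs : Function.support (gradient ψ) ⊆ Ω := fun x hx =>
    (support_fderiv_subset ℝ).trans hs fun h0 => hx (by simp [gradient, h0])
  have e1 : eLpNorm (fderiv ℝ ψ) p volume = eLpNorm (gradient ψ) p (dom Ω) := by
    rw [eLpNorm_restrict_eq_of_support_subset hfs]
    exact eLpNorm_congr_norm_ae (Eventually.of_forall fun x => (norm_gradient ψ x).symm)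
  have hmeas : AEStronglyMeasurable (gradient ψ) (dom Ω) := by
    have : Continuous (gradient ψ) := by
      unfold gradient
      exact (LinearIsometryEquiv.continuous _).comp (hψ.continuous_fderiv (by simp))
    exact this.aestronglyMeasurable
  calc eLpNorm ψ 6 (dom Ω) ≤ eLpNorm ψ 6 volume := eLpNorm_mono_measure _ Measure.restrict_le_self
    _ ≤ C * eLpNorm (gradient ψ) p (dom Ω) := by rw [← e1]; exact_mod_cast key
    _ ≤ C * (eLpNorm (gradient ψ) 2 (dom Ω) *
          dom Ω Set.univ ^ (1 / (p : ℝ≥0∞).toReal - 1 / (2 : ℝ≥0∞).toReal)) := by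
        gcongr
        exact eLpNorm_le_eLpNorm_mul_rpow_measure_univ (by exact_mod_cast hp2) hmeas
    _ = _ := by
        rw [ENNReal.coe_mul, ENNReal.coe_toNNReal hfin]; ring

/-- The Sobolev inequality `‖u‖_{L⁶} ≤ S ‖∇u‖_{L²}` on `H¹₀(Ω)` in dimensions 2 and 3. -/
theorem exists_sobolev (hn : n = 2 ∨ n = 3) (hΩ : IsOpen Ω) (hb : Bornology.IsBounded Ω) :
    ∃ S : ℝ≥0, ∀ u : H10 Ω,
      eLpNorm (embed Ω u) 6 (dom Ω) ≤ S * eLpNorm (grad u) 2 (dom Ω) := by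
  obtain ⟨S, hS⟩ := exists_sobolev_test hn hΩ hb
  refine ⟨S, fun u => ?_⟩
  obtain ⟨w, ψ, hw, hψ⟩ := exists_test_seq u
  have h1 : Tendsto (fun k => embed Ω (w k)) atTop (𝓝 (embed Ω u)) :=
    ((embed Ω).continuous.tendsto u).comp hw
  -- Membership of u in L⁶ is not known beforehand, so the inequality is passed to the limit by
  -- Fatou's lemma along an almost everywhere convergent subsequence.
  obtain ⟨ns, hns, hae⟩ := (tendstoInMeasure_of_tendsto_Lp h1).exists_seq_tendsto_ae
  have h2 : Tendsto (fun k => (S : ℝ≥0∞) * eLpNorm (grad (w (ns k))) 2 (dom Ω)) atTop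
      (𝓝 (S * eLpNorm (grad u) 2 (dom Ω))) := by
    refine ENNReal.Tendsto.const_mul ?_ (Or.inr ENNReal.coe_ne_top)
    have hg : Continuous (grad : H10 Ω → _) := (WithLp.sndL 2 ℝ (Lp ℝ 2 (dom Ω))
      (Lp (EuclideanSpace ℝ (Fin n)) 2 (dom Ω))).continuous.comp (toPair Ω).continuous
    have := (continuous_enorm.comp hg).tendsto u
    simpa only [Function.comp_def, Lp.enorm_def] using (this.comp hw).comp hns.tendsto_atTop
  calc eLpNorm (embed Ω u) 6 (dom Ω)
      ≤ liminf (fun k => eLpNorm (embed Ω (w (ns k))) 6 (dom Ω)) atTop :=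
        Lp.eLpNorm_lim_le_liminf_eLpNorm (fun k => Lp.aestronglyMeasurable _) _ hae
    _ ≤ liminf (fun k => (S : ℝ≥0∞) * eLpNorm (grad (w (ns k))) 2 (dom Ω)) atTop := by
        refine liminf_le_liminf (Eventually.of_forall fun k => ?_)
        obtain ⟨a, b, c, d, e⟩ := hψ (ns k)
        rw [eLpNorm_congr_ae d, eLpNorm_congr_ae e]
        exact hS _ a c
    _ = _ := h2.liminf_eq

end Sobolev

/-! ### The chain rule in H¹₀(Ω) -/

theorem tendsto_eLpNorm_two_of_dominated {α G H : Type*} [MeasurableSpace α] {μ : Measure α}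
    [NormedAddCommGroup G] [NormedAddCommGroup H] {f : ℕ → α → G} {g : α → H}
    (hf : ∀ k, AEStronglyMeasurable (f k) μ) (hg : MemLp g 2 μ)
    (hb : ∀ k, ∀ᵐ x ∂μ, ‖f k x‖ ≤ ‖g x‖)
    (hlim : ∀ᵐ x ∂μ, Tendsto (fun k => f k x) atTop (𝓝 0)) :
    Tendsto (fun k => eLpNorm (f k) 2 μ) atTop (𝓝 0) := by
  have h2 : (2 : ℝ≥0∞) ≠ 0 := by norm_num
  have h2' : (2 : ℝ≥0∞) ≠ ⊤ := by norm_num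
  have key : Tendsto (fun k => ∫⁻ x, ‖f k x‖ₑ ^ (2 : ℝ) ∂μ) atTop (𝓝 (∫⁻ _, 0 ∂μ)) := by
    refine tendsto_lintegral_of_dominated_convergence' (fun x => ‖g x‖ₑ ^ (2 : ℝ))
      (fun k => (hf k).enorm.pow_const _) (fun k => ?_) ?_ ?_
    · filter_upwards [hb k] with x hx
      have : ‖f k x‖ₑ ≤ ‖g x‖ₑ := enorm_le_iff_norm_le.2 hx
      gcongr
    · have := lintegral_rpow_enorm_lt_top_of_eLpNorm_lt_top h2 h2' hg.2
      simpa using this.ne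
    · filter_upwards [hlim] with x hx
      have h0 : Tendsto (fun k => ‖f k x‖ₑ) atTop (𝓝 0) := by
        simpa [Function.comp_def] using (continuous_enorm.tendsto (0 : G)).comp hx
      simpa [Function.comp_def] using
        (ENNReal.continuous_rpow_const (y := (2 : ℝ))).tendsto 0 |>.comp h0
  simp only [lintegral_zero] at key
  have h3 := (ENNReal.continuous_rpow_const (y := (1 / 2 : ℝ))).tendsto 0 |>.comp key
  simpa [eLpNorm_eq_lintegral_rpow_enorm_toReal h2 h2', Function.comp_def] using h3

section Chain

variable {n : ℕ} {Ω : Set (EuclideanSpace ℝ (Fin n))}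

theorem gradient_comp {θ : ℝ → ℝ} (hθ : ContDiff ℝ ∞ θ) {ψ : EuclideanSpace ℝ (Fin n) → ℝ}
    (hψ : ContDiff ℝ ∞ ψ) (x : EuclideanSpace ℝ (Fin n)) :
    gradient (fun x => θ (ψ x)) x = deriv θ (ψ x) • gradient ψ x := by
  have h1 := (hθ.differentiable (by simp) (ψ x)).hasDerivAt
  have h2 := (hψ.differentiable (by simp) x).hasFDerivAt
  have h3 := h1.comp_hasFDerivAt x h2
  have h4 : fderiv ℝ (fun x => θ (ψ x)) x = deriv θ (ψ x) • fderiv ℝ ψ x := h3.fderiv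
  simp [gradient, h4]

/-- The chain rule in `H¹₀(Ω)`. -/
theorem exists_comp {θ : ℝ → ℝ} (hθ : ContDiff ℝ ∞ θ) (h0 : θ 0 = 0) {B : ℝ≥0}
    (hB : ∀ t, ‖deriv θ t‖ ≤ B) (u : H10 Ω) :
    ∃ v : H10 Ω, (embed Ω v =ᵐ[dom Ω] fun x => θ (embed Ω u x)) ∧
      grad v =ᵐ[dom Ω] fun x => deriv θ (embed Ω u x) • grad u x := by
  have hd : Continuous (deriv θ) := hθ.continuous_deriv (by simp)
  have hL : LipschitzWith B θ := lipschitzWith_of_nnnorm_deriv_le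
    (hθ.differentiable (by simp)) hB
  have hmem : ∀ (w : Lp ℝ 2 (dom Ω)) (g : Lp (EuclideanSpace ℝ (Fin n)) 2 (dom Ω)),
      MemLp (fun x => deriv θ (w x) • g x) 2 (dom Ω) := by
    intro w g
    refine MemLp.of_le_mul (c := B) (Lp.memLp g) ?_ (Eventually.of_forall fun x => ?_)
    · exact (hd.comp_aestronglyMeasurable (Lp.aestronglyMeasurable _)).smul
        (Lp.aestronglyMeasurable _)
    · rw [norm_smul]; gcongr; exact hB _
  obtain ⟨w, ψ, hw, hψ⟩ := exists_test_seq u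
  have h1 : Tendsto (fun k => embed Ω (w k)) atTop (𝓝 (embed Ω u)) :=
    ((embed Ω).continuous.tendsto u).comp hw
  obtain ⟨ns, hns, hae⟩ := (tendstoInMeasure_of_tendsto_Lp h1).exists_seq_tendsto_ae
  have hg : Continuous (grad : H10 Ω → _) := (WithLp.sndL 2 ℝ (Lp ℝ 2 (dom Ω))
      (Lp (EuclideanSpace ℝ (Fin n)) 2 (dom Ω))).continuous.comp (toPair Ω).continuous
  have h2 : Tendsto (fun k => grad (w (ns k))) atTop (𝓝 (grad u)) :=
    ((hg.tendsto u).comp hw).comp hns.tendsto_atTop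
  set Θ : H10 Ω → WithLp 2 (Lp ℝ 2 (dom Ω) × Lp (EuclideanSpace ℝ (Fin n)) 2 (dom Ω)) :=
    fun z => WithLp.toLp 2 (hL.compLp h0 (embed Ω z), (hmem (embed Ω z) (grad z)).toLp _) with hΘ
  have hmemT : ∀ k, Θ (w k) ∈ testGraph Ω := by
    intro k
    obtain ⟨a, b, c, d, e⟩ := hψ k
    refine ⟨fun x => θ (ψ k x), hθ.comp a, b.comp_left h0, ?_, ?_, ?_⟩
    · exact (closure_mono (Function.support_comp_subset h0 _)).trans c
    · refine (hL.coeFn_compLp h0 _).trans ?_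
      filter_upwards [d] with x hx
      simp [hx]
    · refine (MemLp.coeFn_toLp (hmem (embed Ω (w k)) (grad (w k)))).trans ?_
      filter_upwards [d, e] with x hx hx'
      rw [gradient_comp hθ a, hx, hx']
  have hlim1 : Tendsto (fun k => (hmem (embed Ω (w (ns k))) (grad (w (ns k)))).toLp _) atTop
      (𝓝 ((hmem (embed Ω u) (grad u)).toLp _)) := by
    -- Inserting θ'(w_k)∇u splits the difference of gradients in two. The part with ∇w_k - ∇u is
    -- controlled by |θ'| ≤ B; the part with θ'(w_k) - θ'(u) tends to 0 almost everywhere and is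
    -- dominated by 2B|∇u|.
    set mid := fun k => (hmem (embed Ω (w (ns k))) (grad u)).toLp _
    have hA : Tendsto (fun k => (hmem (embed Ω (w (ns k))) (grad (w (ns k)))).toLp _ - mid k)
        atTop (𝓝 0) := by
      refine squeeze_zero_norm (a := fun k => (B : ℝ) * ‖grad (w (ns k)) - grad u‖)
        (fun k => ?_) ?_
      · refine Lp.norm_le_mul_norm_of_ae_le_mul ?_
        filter_upwards [Lp.coeFn_sub ((hmem (embed Ω (w (ns k))) (grad (w (ns k)))).toLp _)
          (mid k), MemLp.coeFn_toLp (hmem (embed Ω (w (ns k))) (grad (w (ns k)))),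
          MemLp.coeFn_toLp (hmem (embed Ω (w (ns k))) (grad u)),
          Lp.coeFn_sub (grad (w (ns k))) (grad u)] with x e1 e2 e3 e4
        rw [e1, Pi.sub_apply, e2, e3, e4, Pi.sub_apply, ← smul_sub, norm_smul]
        gcongr; exact hB _
      · have : Tendsto (fun k => grad (w (ns k)) - grad u) atTop (𝓝 0) := by
          simpa using h2.sub_const (grad u)
        simpa using this.norm.const_mul (B : ℝ)
    have hM : Tendsto mid atTop (𝓝 ((hmem (embed Ω u) (grad u)).toLp _)) := by
      rw [Lp.tendsto_Lp_iff_tendsto_eLpNorm'']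
      refine tendsto_eLpNorm_two_of_dominated (g := (2 * B : ℝ) • (grad u : EuclideanSpace ℝ (Fin n) → EuclideanSpace ℝ (Fin n)))
        (fun k => ((hmem _ _).sub (hmem _ _)).1) ((Lp.memLp _).const_smul _)
        (fun k => Eventually.of_forall fun x => ?_) ?_
      · rw [Pi.sub_apply, ← sub_smul, Pi.smul_apply, norm_smul, norm_smul]
        gcongr
        refine (norm_sub_le _ _).trans ?_
        rw [Real.norm_of_nonneg (by positivity : (0 : ℝ) ≤ 2 * B)]
        linarith [hB (embed Ω (w (ns k)) x), hB (embed Ω u x)]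
      · filter_upwards [hae] with x hx
        have := ((hd.tendsto _).comp hx).sub_const (deriv θ (embed Ω u x))
        simpa [sub_smul] using this.smul_const (grad u x)
    simpa using hA.add hM
  have hlim : Tendsto (fun k => Θ (w (ns k))) atTop (𝓝 (Θ u)) := by
    refine ((WithLp.prod_continuous_toLp 2 _ _).tendsto _).comp (Tendsto.prodMk_nhds ?_ hlim1)
    exact (((hL.continuous_compLp h0).tendsto _).comp h1).comp hns.tendsto_atTop
  obtain ⟨v, hv1, hv2⟩ := exists_of_mem_closure
    (mem_closure_of_tendsto hlim (Eventually.of_forall fun k => hmemT (ns k)))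
  refine ⟨v, ?_, ?_⟩
  · rw [hv1]; exact hL.coeFn_compLp h0 _
  · rw [hv2]; exact MemLp.coeFn_toLp (hmem (embed Ω u) (grad u))

end Chain

/-! ### Smooth truncations and Stampacchia's iteration -/

/-- Smooth nonexpansive nondecreasing functions vanishing on the negative half-line. -/
structure IsTruncation (θ : ℝ → ℝ) : Prop where
  contDiff : ContDiff ℝ ∞ θ
  eq_zero : ∀ t ≤ 0, θ t = 0
  nonneg : ∀ t, 0 ≤ θ t
  deriv_nonneg : ∀ t, 0 ≤ deriv θ t
  deriv_le_one : ∀ t, deriv θ t ≤ 1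

/-- A primitive of the smooth transition function serves as a smooth substitute for the positive
part, to which the chain rule above applies directly. Positivity at 1 provides the constant β below.
-/
theorem exists_isTruncation : ∃ η : ℝ → ℝ, IsTruncation η ∧ 0 < η 1 ∧ Monotone η := by
  set η : ℝ → ℝ := fun t => ∫ s in (0 : ℝ)..t, Real.smoothTransition s with hη
  have hd : ∀ t, HasDerivAt η (Real.smoothTransition t) t := fun t =>
    (Real.smoothTransition.continuous).integral_hasStrictDerivAt 0 t |>.hasDerivAt
  have hderiv : deriv η = Real.smoothTransition := funext fun t => (hd t).deriv
  have hm : Monotone η := monotone_of_deriv_nonneg (fun t => (hd t).differentiableAt) fun t => by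
    rw [hderiv]; exact Real.smoothTransition.nonneg t
  have h0 : ∀ t ≤ 0, η t = 0 := by
    intro t ht
    have : ∫ s in (0 : ℝ)..t, Real.smoothTransition s = ∫ s in (0 : ℝ)..t, (0 : ℝ) := by
      refine intervalIntegral.integral_congr fun s hs => ?_
      rw [Set.uIcc_of_ge ht] at hs
      exact Real.smoothTransition.zero_of_nonpos hs.2
    simpa [hη] using this
  refine ⟨η, ⟨?_, h0, ?_, ?_, ?_⟩, ?_, hm⟩
  · rw [contDiff_infty_iff_deriv, hderiv]
    exact ⟨fun t => (hd t).differentiableAt, Real.smoothTransition.contDiff⟩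
  · intro t
    rcases le_total t 0 with h | h
    · exact (h0 t h).ge
    · exact (h0 0 le_rfl).ge.trans (hm h)
  · intro t; rw [hderiv]; exact Real.smoothTransition.nonneg t
  · intro t; rw [hderiv]; exact Real.smoothTransition.le_one t
  · exact intervalIntegral.intervalIntegral_pos_of_pos_on
      (Real.smoothTransition.continuous.intervalIntegrable _ _)
      (fun s hs => Real.smoothTransition.pos_of_pos hs.1) one_pos

/-- Truncations that vanish below `k` and grow to a fixed fraction of `h - k` at `h`. -/
theorem exists_isTruncation_between : ∃ β : ℝ, 0 < β ∧ ∀ k h : ℝ, 0 ≤ k → k < h →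
    ∃ θ : ℝ → ℝ, IsTruncation θ ∧ (∀ t ≤ k, θ t = 0) ∧ ∀ t, h ≤ t → β * (h - k) ≤ θ t := by
  obtain ⟨η, hη, h1, hm⟩ := exists_isTruncation
  -- Rescaling to (h - k) η((t - k)/(h - k)) leaves the range of the derivative unchanged, so the
  -- fraction η(1) reached at h does not depend on the levels.
  refine ⟨η 1, h1, fun k h hk hkh => ?_⟩
  have hpos : 0 < h - k := sub_pos.2 hkh
  have hd : ∀ t, HasDerivAt (fun t => (h - k) * η ((t - k) / (h - k)))
      (deriv η ((t - k) / (h - k))) t := by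
    intro t
    have a : HasDerivAt (fun t => (t - k) / (h - k)) (1 / (h - k)) t :=
      ((hasDerivAt_id t).sub_const k).div_const _
    have b := (hη.contDiff.differentiable (by simp) ((t - k) / (h - k))).hasDerivAt
    have c := (b.comp t a).const_mul (h - k)
    refine c.congr_deriv ?_
    have := hpos.ne'
    field_simp
  have hz : ∀ t ≤ k, (h - k) * η ((t - k) / (h - k)) = 0 := fun t ht => by
    rw [hη.eq_zero _ (div_nonpos_of_nonpos_of_nonneg (by linarith) hpos.le), mul_zero]
  refine ⟨fun t => (h - k) * η ((t - k) / (h - k)), ⟨?_, ?_, ?_, ?_, ?_⟩, hz, ?_⟩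
  · exact contDiff_const.mul (hη.contDiff.comp (by fun_prop))
  · exact fun t ht => hz t (ht.trans hk)
  · exact fun t => mul_nonneg hpos.le (hη.nonneg _)
  · intro t; rw [(hd t).deriv]; exact hη.deriv_nonneg _
  · intro t; rw [(hd t).deriv]; exact hη.deriv_le_one _
  · intro t ht
    rw [mul_comm]
    refine mul_le_mul_of_nonneg_left ?_ hpos.le
    exact hm ((one_le_div hpos).2 (by linarith))

/-- Stampacchia's iteration lemma. -/
theorem eq_zero_of_levelset_decay {m : ℝ → ℝ} {Q m0 T : ℝ} (hm : Antitone m)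
    (hm0 : ∀ k, 0 ≤ m k) (h0 : m 0 ≤ m0) (hQ : 0 ≤ Q) (hT : 0 < T) (hQT : Q * 2 ^ 12 * m0 ≤ T ^ 6)
    (hrec : ∀ k h, 0 ≤ k → k < h → (h - k) ^ 6 * m h ≤ Q * m k ^ 2) : m T = 0 := by
  have hm00 : 0 ≤ m0 := (hm0 0).trans h0
  -- The levels T(1 - 2⁻ʲ) increase to T, and the measures decay like 2⁻⁶ʲ. One step needs Q m0² r¹²
  -- ≤ (Tr/2)⁶ m0 (r/2)⁶ with r = 2⁻ʲ, which is where the factor 2¹² in the hypothesis on T comes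
  -- from. The power 2 of `m k` in the recursion, being larger than 1, makes the induction close.
  have key : ∀ j : ℕ, m (T * (1 - (1 / 2) ^ j)) ≤ m0 * ((1 / 2) ^ j) ^ 6 := by
    intro j
    induction j with
    | zero => simpa using h0
    | succ j ih =>
      set r : ℝ := (1 / 2) ^ j with hr
      have hr0 : 0 < r := by positivity
      have hr1 : r ≤ 1 := pow_le_one₀ (by norm_num) (by norm_num)
      have e : (1 / 2 : ℝ) ^ (j + 1) = r / 2 := by rw [pow_succ]; ring
      rw [e]
      have a := hrec (T * (1 - r)) (T * (1 - r / 2)) (mul_nonneg hT.le (by linarith))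
        (by gcongr; linarith)
      have b : T * (1 - r / 2) - T * (1 - r) = T * r / 2 := by ring
      rw [b] at a
      have c : m (T * (1 - r)) ^ 2 ≤ (m0 * r ^ 6) ^ 2 := by
        gcongr; exact hm0 _
      have d : (T * r / 2) ^ 6 * m (T * (1 - r / 2)) ≤ (T * r / 2) ^ 6 * (m0 * (r / 2) ^ 6) := by
        calc (T * r / 2) ^ 6 * m (T * (1 - r / 2)) ≤ Q * (m0 * r ^ 6) ^ 2 := a.trans (by gcongr)
          _ = (Q * 2 ^ 12 * m0) * (m0 * r ^ 12 / 2 ^ 12) := by ring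
          _ ≤ T ^ 6 * (m0 * r ^ 12 / 2 ^ 12) := by gcongr
          _ = _ := by ring
      exact le_of_mul_le_mul_left d (by positivity)
  refine le_antisymm ?_ (hm0 T)
  have hlim : Tendsto (fun j : ℕ => m0 * ((1 / 2 : ℝ) ^ j) ^ 6) atTop (𝓝 0) := by
    have := (tendsto_pow_atTop_nhds_zero_of_lt_one (r := (1 / 2 : ℝ)) (by norm_num)
      (by norm_num)).pow 6
    simpa using this.const_mul m0
  refine ge_of_tendsto' hlim fun j => le_trans (hm ?_) (key j)
  have : (0 : ℝ) ≤ (1 / 2) ^ j := by positivity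
  nlinarith

/-! ### Coercivity against truncations and L^∞ bounds -/

theorem integrable_mul_L2 {α : Type*} [MeasurableSpace α] {μ : Measure α} (f g : Lp ℝ 2 μ) :
    Integrable (fun x => f x * g x) μ :=
  (Lp.memLp f).integrable_mul (Lp.memLp g)

theorem norm_sq_eq_integral {α G : Type*} [MeasurableSpace α] {μ : Measure α}
    [NormedAddCommGroup G] [InnerProductSpace ℝ G] (f : Lp G 2 μ) :
    ‖f‖ ^ 2 = ∫ x, ‖f x‖ ^ 2 ∂μ := by
  rw [← real_inner_self_eq_norm_sq, L2.inner_def]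
  simp

namespace Problem

variable {n : ℕ} (P : Problem n)

theorem mulOp_apply (b : Lp ℝ ∞ (dom P.Ω)) (u v : H10 P.Ω) :
    mulOp b u v = ∫ x, mulL b (embed P.Ω u) x * embed P.Ω v x ∂(dom P.Ω) :=
  gelfand_apply _ _

theorem A_apply (u v : H10 P.Ω) :
    P.A u v = ∫ x, ((∑ i, ∑ j, mulL (P.a i j) (partialD P.Ω i u) x * partialD P.Ω j v x)
      + mulL P.a₀ (embed P.Ω u) x * embed P.Ω v x) ∂(dom P.Ω) := by
  have hs : ∀ i, Integrable (fun x => ∑ j, mulL (P.a i j) (partialD P.Ω i u) x *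
      partialD P.Ω j v x) (dom P.Ω) :=
    fun i => integrable_finsetSum _ fun j _ => integrable_mul_L2 _ _
  rw [integral_add (integrable_finsetSum _ fun i _ => hs i) (integrable_mul_L2 _ _),
    integral_finsetSum _ fun i _ => hs i]
  simp_rw [integral_finsetSum _ fun j _ => integrable_mul_L2 _ _]
  simp [A, mulOp_apply, dualOf_apply]

/-- Since ∇v = θ'(u)∇u, the principal part is θ'(u) times the quadratic form at ∇u, hence at least
cθ'(u)|∇u|², and 0 ≤ θ' ≤ 1 makes this at least c|∇v|². The zero-order term is nonnegative because
θ(u) is nonnegative and vanishes where u ≤ 0. -/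
theorem exists_coercive : ∃ c : ℝ, 0 < c ∧ ∀ (θ : ℝ → ℝ), IsTruncation θ → ∀ u v : H10 P.Ω,
    (embed P.Ω v =ᵐ[dom P.Ω] fun x => θ (embed P.Ω u x)) →
    (grad v =ᵐ[dom P.Ω] fun x => deriv θ (embed P.Ω u x) • grad u x) →
    c * ‖grad v‖ ^ 2 ≤ P.A u v := by
  obtain ⟨c, hc, hell⟩ := P.elliptic
  refine ⟨c, hc, fun θ hθ u v hv hg => ?_⟩
  rw [A_apply, norm_sq_eq_integral, ← integral_const_mul]
  refine integral_mono_ae ?_ ?_ ?_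
  · exact ((Lp.memLp (grad v)).integrable_norm_pow (by norm_num)).const_mul c
  · exact (integrable_finsetSum _ fun i _ => integrable_finsetSum _ fun j _ =>
      integrable_mul_L2 _ _).add (integrable_mul_L2 _ _)
  · have h1 : ∀ᵐ x ∂(dom P.Ω), ∀ i j, mulL (P.a i j) (partialD P.Ω i u) x
        = P.a i j x * partialD P.Ω i u x :=
      ae_all_iff.2 fun i => ae_all_iff.2 fun j => mulL_ae _ _
    have h2 : ∀ᵐ x ∂(dom P.Ω), ∀ i, partialD P.Ω i u x = grad u x i :=
      ae_all_iff.2 fun i => partialD_apply_ae _ _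
    have h3 : ∀ᵐ x ∂(dom P.Ω), ∀ i, partialD P.Ω i v x = grad v x i :=
      ae_all_iff.2 fun i => partialD_apply_ae _ _
    filter_upwards [h1, h2, h3, mulL_ae P.a₀ (embed P.Ω u), hv, hg, hell, P.a₀_nonneg]
      with x e1 e2 e3 e4 ev eg he h0
    simp only [e1, e2, e3, e4, ev, eg]
    set s := deriv θ (embed P.Ω u x)
    have hs0 : 0 ≤ s := hθ.deriv_nonneg _
    have hs1 : s ≤ 1 := hθ.deriv_le_one _
    have hpos : 0 ≤ P.a₀ x * embed P.Ω u x * θ (embed P.Ω u x) := by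
      rw [mul_assoc]
      refine mul_nonneg h0 ?_
      rcases le_total (embed P.Ω u x) 0 with h | h
      · rw [hθ.eq_zero _ h, mul_zero]
      · exact mul_nonneg h (hθ.nonneg _)
    have hsum : ∑ i, ∑ j, P.a i j x * grad u x i * (s • grad u x) j
        = s * ∑ i, ∑ j, P.a i j x * grad u x i * grad u x j := by
      simp_rw [Finset.mul_sum]
      refine Finset.sum_congr rfl fun i _ => Finset.sum_congr rfl fun j _ => ?_
      simp; ring
    rw [hsum, norm_smul, Real.norm_of_nonneg hs0]
    have h4 := mul_le_mul_of_nonneg_left (he (grad u x)) hs0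
    have h5 : s ^ 2 * (c * ‖grad u x‖ ^ 2) ≤ s * (c * ‖grad u x‖ ^ 2) := by
      gcongr; nlinarith
    nlinarith

end Problem

theorem integral_mul_le_norm {α : Type*} [MeasurableSpace α] {μ : Measure α} (f g : Lp ℝ 2 μ) :
    ∫ x, f x * g x ∂μ ≤ ‖f‖ * ‖g‖ := by
  have h := real_inner_le_norm g f
  rw [L2.inner_def] at h
  simpa [mul_comm] using h

/-- Hölder's inequality between `L²` and `L⁶` for functions supported in `s`. -/
theorem eLpNorm_two_le_of_support {α : Type*} [MeasurableSpace α] {μ : Measure α} {f : α → ℝ}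
    (hf : AEStronglyMeasurable f μ) {s : Set α} (hs : Function.support f ⊆ s) :
    eLpNorm f 2 μ ≤ eLpNorm f 6 μ * μ s ^ (1 / 3 : ℝ) := by
  rw [← eLpNorm_restrict_eq_of_support_subset hs]
  refine (eLpNorm_le_eLpNorm_mul_rpow_measure_univ (p := 2) (q := 6) (by norm_num)
    hf.restrict).trans ?_
  have e : 1 / (2 : ℝ≥0∞).toReal - 1 / (6 : ℝ≥0∞).toReal = 1 / 3 := by norm_num
  rw [e, Measure.restrict_apply_univ]
  gcongr
  exact Measure.restrict_le_self

namespace Problem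

variable {n : ℕ} (P : Problem n)

/-- Testing with v = θ(u), where θ vanishes below k, combines coercivity, Cauchy–Schwarz, Sobolev
and Hölder on {u > k} into ‖v‖₆ ≤ (S²/c)‖g‖ m^(1/3), with m the measure of that set. Since v ≥ β(h -
k) where u > h, Chebyshev in L⁶ gives the claim; the sixth power turns m^(1/3) into m². -/
theorem levelset_decay (hn : n = 2 ∨ n = 3) : ∃ K : ℝ, 0 ≤ K ∧ ∀ (u : H10 P.Ω)
    (g : Lp ℝ 2 (dom P.Ω)),
    (∀ θ : ℝ → ℝ, IsTruncation θ → ∀ v : H10 P.Ω,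
      (embed P.Ω v =ᵐ[dom P.Ω] fun x => θ (embed P.Ω u x)) →
      P.A u v ≤ ∫ x, g x * embed P.Ω v x ∂(dom P.Ω)) →
    ∀ k h, 0 ≤ k → k < h → (h - k) ^ 6 * (dom P.Ω).real {x | h < embed P.Ω u x} ≤
      (K * ‖g‖) ^ 6 * (dom P.Ω).real {x | k < embed P.Ω u x} ^ 2 := by
  obtain ⟨S, hS⟩ := exists_sobolev hn P.isOpen P.isBounded
  obtain ⟨c, hc, hcoer⟩ := P.exists_coercive
  obtain ⟨β, hβ, htr⟩ := exists_isTruncation_between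
  refine ⟨S ^ 2 / c / β, by positivity, fun u g hu k h hk hkh => ?_⟩
  obtain ⟨θ, hθ, hθk, hθh⟩ := htr k h hk hkh
  obtain ⟨v, hv, hgv⟩ := exists_comp (B := 1) hθ.contDiff (hθ.eq_zero 0 le_rfl)
    (fun t => by
      rw [Real.norm_of_nonneg (hθ.deriv_nonneg t)]; exact hθ.deriv_le_one t) u
  set m := (dom P.Ω).real {x | k < embed P.Ω u x}
  have hSv : eLpNorm (embed P.Ω v) 6 (dom P.Ω) ≤ S * ENNReal.ofReal ‖grad v‖ := by
    refine (hS v).trans_eq ?_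
    rw [ofReal_norm, Lp.enorm_def]
  set q := (eLpNorm (embed P.Ω v) 6 (dom P.Ω)).toReal
  have hfin : eLpNorm (embed P.Ω v) 6 (dom P.Ω) ≠ ⊤ :=
    (hSv.trans_lt (ENNReal.mul_lt_top ENNReal.coe_lt_top ENNReal.ofReal_lt_top)).ne
  have hq0 : 0 ≤ q := ENNReal.toReal_nonneg
  have hq1 : q ≤ S * ‖grad v‖ := by
    have := ENNReal.toReal_mono
      (ENNReal.mul_ne_top ENNReal.coe_ne_top ENNReal.ofReal_ne_top) hSv
    simpa using this
  have hm0 : 0 ≤ m := measureReal_nonneg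
  have hv2 : ‖embed P.Ω v‖ ≤ q * m ^ (1 / 3 : ℝ) := by
    have h1 : eLpNorm (embed P.Ω v) 2 (dom P.Ω) ≤ eLpNorm (embed P.Ω v) 6 (dom P.Ω) *
        dom P.Ω {x | k < embed P.Ω u x} ^ (1 / 3 : ℝ) := by
      rw [eLpNorm_congr_ae hv, eLpNorm_congr_ae hv]
      refine eLpNorm_two_le_of_support
        (hθ.contDiff.continuous.comp_aestronglyMeasurable (Lp.aestronglyMeasurable _)) ?_
      intro x hx
      by_contra hcon
      exact hx (hθk _ (not_lt.1 hcon))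
    have h2 := ENNReal.toReal_mono (ENNReal.mul_ne_top hfin
      (ENNReal.rpow_ne_top_of_nonneg (by norm_num) (measure_ne_top _ _))) h1
    rw [ENNReal.toReal_mul, ← ENNReal.toReal_rpow] at h2
    exact h2
  have hA : c * ‖grad v‖ ^ 2 ≤ ‖g‖ * (q * m ^ (1 / 3 : ℝ)) :=
    (hcoer θ hθ u v hv hgv).trans <| (hu θ hθ v hv).trans <| (integral_mul_le_norm _ _).trans
      (by gcongr)
  have hq2 : q ≤ S ^ 2 / c * ‖g‖ * m ^ (1 / 3 : ℝ) := by
    rcases hq0.eq_or_lt with hq | hq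
    · rw [← hq]; positivity
    · have h1 : q ^ 2 ≤ S ^ 2 * ‖grad v‖ ^ 2 := by rw [← mul_pow]; gcongr
      have h2 : c * (q * q) ≤ c * (q * (S ^ 2 / c * ‖g‖ * m ^ (1 / 3 : ℝ))) := by
        calc c * (q * q) ≤ S ^ 2 * (c * ‖grad v‖ ^ 2) := by nlinarith
          _ ≤ S ^ 2 * (‖g‖ * (q * m ^ (1 / 3 : ℝ))) := by gcongr
          _ = _ := by field_simp
      exact le_of_mul_le_mul_left (le_of_mul_le_mul_left h2 hc) hq
  have hcheb : (β * (h - k)) ^ 6 * (dom P.Ω).real {x | h < embed P.Ω u x} ≤ q ^ 6 := by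
    have hpos : 0 < β * (h - k) := mul_pos hβ (sub_pos.2 hkh)
    have h1 := mul_meas_ge_le_pow_eLpNorm' (dom P.Ω) (p := 6) (by norm_num) (by norm_num)
      (Lp.aestronglyMeasurable (embed P.Ω v)) (ENNReal.ofReal (β * (h - k)))
    have h2 : (dom P.Ω) {x | h < embed P.Ω u x} ≤
        (dom P.Ω) {x | ENNReal.ofReal (β * (h - k)) ≤ ‖embed P.Ω v x‖ₑ} := by
      refine measure_mono_ae ?_
      filter_upwards [hv] with x hx hxh
      have : β * (h - k) ≤ ‖embed P.Ω v x‖ := by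
        rw [hx]; exact (hθh _ (le_of_lt hxh)).trans (le_abs_self _)
      show ENNReal.ofReal (β * (h - k)) ≤ ‖embed P.Ω v x‖ₑ
      rw [← ofReal_norm]
      exact ENNReal.ofReal_le_ofReal this
    have h3 : ENNReal.ofReal (β * (h - k)) ^ (6 : ℝ≥0∞).toReal * (dom P.Ω) {x | h < embed P.Ω u x} ≤
        eLpNorm (embed P.Ω v) 6 (dom P.Ω) ^ (6 : ℝ≥0∞).toReal := le_trans (by gcongr) h1
    have h4 := ENNReal.toReal_mono (ENNReal.rpow_ne_top_of_nonneg (by norm_num) hfin) h3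
    rw [ENNReal.toReal_mul, ← ENNReal.toReal_rpow, ← ENNReal.toReal_rpow,
      ENNReal.toReal_ofReal hpos.le] at h4
    have e6 : (6 : ℝ≥0∞).toReal = ((6 : ℕ) : ℝ) := by norm_num
    rw [e6, Real.rpow_natCast, Real.rpow_natCast] at h4
    exact h4
  have hm6 : (m ^ (1 / 3 : ℝ)) ^ 6 = m ^ 2 := by
    rw [← Real.rpow_natCast, ← Real.rpow_mul hm0, ← Real.rpow_natCast]; norm_num
  have h6 : q ^ 6 ≤ (S ^ 2 / c * ‖g‖) ^ 6 * m ^ 2 := by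
    rw [← hm6, ← mul_pow]; gcongr
  have hfinal := hcheb.trans h6
  have hβ6 : 0 < β ^ 6 := by positivity
  refine le_of_mul_le_mul_left ?_ hβ6
  calc _ = (β * (h - k)) ^ 6 * (dom P.Ω).real {x | h < embed P.Ω u x} := by ring
    _ ≤ _ := hfinal
    _ = _ := by field_simp

/-- Stampacchia's bound for subsolutions. -/
theorem exists_ae_le (hn : n = 2 ∨ n = 3) : ∃ K : ℝ, ∀ (u : H10 P.Ω)
    (g : Lp ℝ 2 (dom P.Ω)),
    (∀ θ : ℝ → ℝ, IsTruncation θ → ∀ v : H10 P.Ω,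
      (embed P.Ω v =ᵐ[dom P.Ω] fun x => θ (embed P.Ω u x)) →
      P.A u v ≤ ∫ x, g x * embed P.Ω v x ∂(dom P.Ω)) →
    ∀ᵐ x ∂(dom P.Ω), embed P.Ω u x ≤ K * (‖g‖ + 1) := by
  obtain ⟨K, hK, hdec⟩ := P.levelset_decay hn
  set m0 := (dom P.Ω).real Set.univ
  have hm0 : 0 ≤ m0 := measureReal_nonneg
  -- The factor 4 accounts for 2¹² = 4⁶, and m0 ≤ (m0 + 1)⁶ by Bernoulli. The added ones keep T
  -- positive in degenerate cases.
  refine ⟨(K + 1) * 4 * (m0 + 1), fun u g hu => ?_⟩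
  set T := (K + 1) * 4 * (m0 + 1) * (‖g‖ + 1)
  have hg := norm_nonneg g
  have hz := eq_zero_of_levelset_decay (m := fun k => (dom P.Ω).real {x | k < embed P.Ω u x})
    (Q := (K * ‖g‖) ^ 6) (m0 := m0) (T := T)
    (fun k h hkh => measureReal_mono fun x (hx : h < _) => lt_of_le_of_lt hkh hx)
    (fun k => measureReal_nonneg) (measureReal_mono (Set.subset_univ _)) (by positivity)
    (by positivity) ?_ (hdec u g hu)
  · have h0 : (dom P.Ω) {x | T < embed P.Ω u x} = 0 :=
      (measureReal_eq_zero_iff (measure_ne_top _ _)).1 hz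
    have := measure_eq_zero_iff_ae_notMem.1 h0
    filter_upwards [this] with x hx
    exact not_lt.1 hx
  · have h1 : m0 ≤ (m0 + 1) ^ 6 := by
      have := one_add_mul_le_pow (a := m0) (by linarith) 6
      rw [add_comm m0 1]
      refine le_trans ?_ this
      push_cast; linarith
    calc (K * ‖g‖) ^ 6 * 2 ^ 12 * m0 ≤ ((K + 1) * (‖g‖ + 1)) ^ 6 * 2 ^ 12 * (m0 + 1) ^ 6 := by
          gcongr <;> linarith
      _ = T ^ 6 := by simp only [T]; ring

end Problem

/-- The two square roots are the Euclidean norms of (t + 1, √ε) and (t - 1, √ε), which differ by at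
most 2. Uniformity in ε is what bounds the control term in the state equation. -/
theorem abs_smoothProj_le_one {ε : ℝ} (hε : 0 ≤ ε) (t : ℝ) : |smoothProj ε t| ≤ 1 := by
  have h1 := Real.sq_sqrt (by positivity : 0 ≤ (t + 1) ^ 2 + ε)
  have h2 := Real.sq_sqrt (by positivity : 0 ≤ (t - 1) ^ 2 + ε)
  set a := Real.sqrt ((t + 1) ^ 2 + ε)
  set b := Real.sqrt ((t - 1) ^ 2 + ε)
  have ha : |t + 1| ≤ a := Real.abs_le_sqrt (by linarith)
  have hb : |t - 1| ≤ b := Real.abs_le_sqrt (by linarith)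
  have ha0 : 0 ≤ a := (abs_nonneg _).trans ha
  have hb0 : 0 ≤ b := (abs_nonneg _).trans hb
  have h3 : a ≤ b + 2 := by
    nlinarith [le_abs_self (t - 1), neg_abs_le (t - 1)]
  have h4 : b ≤ a + 2 := by
    nlinarith [le_abs_self (t + 1), neg_abs_le (t + 1)]
  have : smoothProj ε t = (a - b) / 2 := rfl
  rw [this, abs_le]
  constructor <;> linarith

namespace Problem

variable {n : ℕ} (P : Problem n)

/-- Stampacchia's `L^∞` bound for solutions of `A u + b = g`, where `b` has the sign of `u`. -/
theorem exists_ae_abs_le (hn : n = 2 ∨ n = 3) : ∃ K : ℝ, ∀ (u : H10 P.Ω)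
    (g b : Lp ℝ 2 (dom P.Ω)), (∀ᵐ x ∂(dom P.Ω), 0 ≤ b x * embed P.Ω u x) →
    P.A u = gelfand P.Ω (g - b) → ∀ᵐ x ∂(dom P.Ω), |embed P.Ω u x| ≤ K * (‖g‖ + 1) := by
  obtain ⟨K, hK⟩ := P.exists_ae_le hn
  have main : ∀ (u : H10 P.Ω)
      (g b : Lp ℝ 2 (dom P.Ω)), (∀ᵐ x ∂(dom P.Ω), 0 ≤ b x * embed P.Ω u x) →
      P.A u = gelfand P.Ω (g - b) → ∀ᵐ x ∂(dom P.Ω), embed P.Ω u x ≤ K * (‖g‖ + 1) := by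
    intro u g b hb hA
    refine hK u g fun θ hθ v hv => ?_
    rw [hA, gelfand_apply]
    -- Where θ(u) is nonzero, u is positive and so b ≥ 0; hence bθ(u) can be dropped and u is a
    -- subsolution with source g.
    refine integral_mono_ae (integrable_mul_L2 _ _) (integrable_mul_L2 _ _) ?_
    filter_upwards [hb, hv, Lp.coeFn_sub g b] with x h1 h2 h3
    rw [h2, h3, Pi.sub_apply, sub_mul, sub_le_self_iff]
    rcases le_or_gt (embed P.Ω u x) 0 with h | h
    · rw [hθ.eq_zero _ h, mul_zero]
    · exact mul_nonneg (nonneg_of_mul_nonneg_left h1 h) (hθ.nonneg _)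
  refine ⟨K, fun u g b hb hA => ?_⟩
  have h2 := main (-u) (-g) (-b) ?_ ?_
  · filter_upwards [main u g b hb hA, h2, Lp.coeFn_neg (embed P.Ω u)] with x a1 a2 a3
    rw [map_neg, a3, norm_neg, Pi.neg_apply] at a2
    exact abs_le.2 ⟨by linarith, a1⟩
  · filter_upwards [hb, Lp.coeFn_neg (embed P.Ω u), Lp.coeFn_neg b] with x a1 a2 a3
    rw [map_neg, a2, a3]
    simpa using a1
  · rw [map_neg, hA, ← map_neg]; congr 1; abel

theorem toL2_ae (b : Lp ℝ ∞ (dom P.Ω)) : P.toL2 b =ᵐ[dom P.Ω] b := MemLp.coeFn_toLp _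

variable {P}

theorem Bdd.phiY_ae (x : P.Bdd) : x.phiY =ᵐ[dom P.Ω] fun t => P.φ (embed P.Ω x.y t) :=
  MemLp.coeFn_toLp _

theorem Bdd.dphiY_ae (x : P.Bdd) : x.dphiY =ᵐ[dom P.Ω] fun t => deriv P.φ (embed P.Ω x.y t) :=
  MemLp.coeFn_toLp _

theorem Bdd.ddphiYP_ae (x : P.Bdd) : x.ddphiYP =ᵐ[dom P.Ω]
    fun t => deriv (deriv P.φ) (embed P.Ω x.y t) * embed P.Ω x.p t :=
  MemLp.coeFn_toLp _

theorem Bdd.projP_ae (x : P.Bdd) (ε : ℝ) : x.projP ε =ᵐ[dom P.Ω]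
    fun t => smoothProj ε (-(embed P.Ω x.p t) / P.mu) :=
  MemLp.coeFn_toLp _

theorem Bdd.dprojP_ae (x : P.Bdd) {ε : ℝ} (hε : 0 < ε) : x.dprojP hε =ᵐ[dom P.Ω]
    fun t => deriv (smoothProj ε) (-(embed P.Ω x.p t) / P.mu) :=
  MemLp.coeFn_toLp _

theorem Bdd.norm_y_le (x : P.Bdd) : ‖x.y‖ ≤ ‖x.1‖ := WithLp.norm_fst_le _ x.1

theorem Bdd.norm_p_le (x : P.Bdd) : ‖x.p‖ ≤ ‖x.1‖ := WithLp.norm_snd_le _ x.1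

variable (P)

/-- Uniform `L^∞` bounds for the solutions of the smoothed optimality systems. -/
theorem exists_uniform_bound (hn : n = 2 ∨ n = 3) (R : ℝ) : ∃ M : ℝ, ∀ (ε : ℝ), 0 ≤ ε →
    ∀ x : P.Bdd, P.F x ε = 0 → ‖x.1‖ ≤ R →
      ∀ᵐ t ∂(dom P.Ω), |embed P.Ω x.y t| ≤ M ∧ |embed P.Ω x.p t| ≤ M := by
  obtain ⟨K, hK⟩ := P.exists_ae_abs_le hn
  set one := Lp.const 2 (dom P.Ω) (1 : ℝ)
  set N1 := ‖P.f‖ + ‖P.φ 0 • one‖ + 1 / P.nu * (R + P.mu * ‖one‖)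
  set N2 := R + ‖P.yd‖
  refine ⟨max (|K| * (N1 + 1)) (|K| * (N2 + 1)), fun ε hε x hx hxR => ?_⟩
  have hF1 : P.A x.y + gelfand P.Ω (P.toL2 x.phiY - P.f
        + (1 / P.nu) • (embed P.Ω x.p + P.mu • P.toL2 (x.projP ε))) = 0 :=
    congrArg WithLp.fst hx
  have hF2 : P.A x.p + gelfand P.Ω (mulL x.dphiY (embed P.Ω x.p) - embed P.Ω x.y + P.yd) = 0 :=
    congrArg WithLp.snd hx
  have hproj : ‖P.toL2 (x.projP ε)‖ ≤ ‖one‖ := by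
    refine Lp.norm_le_norm_of_ae_le ?_
    filter_upwards [P.toL2_ae (x.projP ε), x.projP_ae ε, Lp.coeFn_const (p := 2)
      (μ := dom P.Ω) (c := (1 : ℝ))] with t h1 h2 h3
    rw [h1, h2, h3]
    simpa using abs_smoothProj_le_one hε _
  have hp := (norm_embed_le x.p).trans (x.norm_p_le.trans hxR)
  have hy := (norm_embed_le x.y).trans (x.norm_y_le.trans hxR)
  -- Moving φ(0) into the source leaves φ(y) - φ(0), which has the sign of y. No growth condition on
  -- φ is thus needed, and the norm of the source depends only on R and the data.
  have B1 := hK x.y (P.f - P.φ 0 • one - (1 / P.nu) • (embed P.Ω x.p + P.mu • P.toL2 (x.projP ε)))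
    (P.toL2 x.phiY - P.φ 0 • one) ?_ ?_
  · have B2 := hK x.p (embed P.Ω x.y - P.yd) (mulL x.dphiY (embed P.Ω x.p)) ?_ ?_
    · have n1 : ‖P.f - P.φ 0 • one -
          (1 / P.nu) • (embed P.Ω x.p + P.mu • P.toL2 (x.projP ε))‖ ≤ N1 := by
        refine (norm_sub_le _ _).trans (add_le_add (norm_sub_le _ _) ?_)
        have h1 : 0 ≤ 1 / P.nu := (one_div_pos.2 P.nu_pos).le
        have h2 := P.mu_pos
        rw [norm_smul, Real.norm_of_nonneg h1]
        gcongr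
        refine (norm_add_le _ _).trans (add_le_add hp ?_)
        rw [norm_smul, Real.norm_of_nonneg h2.le]
        gcongr
      have n2 : ‖embed P.Ω x.y - P.yd‖ ≤ N2 := (norm_sub_le _ _).trans (add_le_add hy le_rfl)
      filter_upwards [B1, B2] with t h1 h2
      constructor
      · refine (h1.trans ?_).trans (le_max_left _ _)
        gcongr; exact le_abs_self K
      · refine (h2.trans ?_).trans (le_max_right _ _)
        gcongr; exact le_abs_self K
    · filter_upwards [mulL_ae x.dphiY (embed P.Ω x.p), x.dphiY_ae] with t h1 h2
      rw [h1, h2, mul_assoc]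
      exact mul_nonneg P.φ_mono.deriv_nonneg (mul_self_nonneg _)
    · rw [eq_neg_of_add_eq_zero_left hF2, ← map_neg]; congr 1; abel
  · filter_upwards [Lp.coeFn_sub (P.toL2 x.phiY) (P.φ 0 • one), P.toL2_ae x.phiY, x.phiY_ae,
      Lp.coeFn_smul (P.φ 0) one, Lp.coeFn_const (p := 2)
      (μ := dom P.Ω) (c := (1 : ℝ))] with t h1 h2 h3 h4 h5
    rw [h1, Pi.sub_apply, h2, h3, h4, Pi.smul_apply, h5]
    simp only [Function.const_apply, smul_eq_mul, mul_one]
    rcases le_total (embed P.Ω x.y t) 0 with h | h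
    · exact mul_nonneg_of_nonpos_of_nonpos (sub_nonpos.2 (P.φ_mono h)) h
    · exact mul_nonneg (sub_nonneg.2 (P.φ_mono h)) h
  · rw [eq_neg_of_add_eq_zero_left hF1, ← map_neg]; congr 1; abel

end Problem

/-! ### Pointwise remainder estimates for the smoothed projection -/

theorem abs_sqrt_sub_abs_le {ε : ℝ} (hε : 0 ≤ ε) (s : ℝ) :
    |(√(s ^ 2 + ε) - |s|)| ≤ √ε := by
  have h1 : |s| ≤ √(s ^ 2 + ε) := Real.abs_le_sqrt (by linarith)
  have h2 : √(s ^ 2 + ε) ≤ |s| + √ε := by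
    refine Real.sqrt_le_iff.2 ⟨by positivity, ?_⟩
    nlinarith [sq_abs s, Real.sq_sqrt hε, mul_nonneg (abs_nonneg s) (Real.sqrt_nonneg ε)]
  rw [abs_of_nonneg (by linarith)]
  linarith

/-- Smoothing shifts each absolute value by at most √ε, and P_0, half the difference of two
1-Lipschitz functions, is 1-Lipschitz. This serves to pass to the limit in F. -/
theorem abs_smoothProj_sub_le {ε : ℝ} (hε : 0 ≤ ε) (s t : ℝ) :
    |smoothProj ε s - smoothProj 0 t| ≤ |s - t| + √ε := by
  have h1 := abs_sqrt_sub_abs_le hε (s + 1)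
  have h2 := abs_sqrt_sub_abs_le hε (s - 1)
  have h3 := abs_abs_sub_abs_le_abs_sub (s + 1) (t + 1)
  have h4 := abs_abs_sub_abs_le_abs_sub (s - 1) (t - 1)
  rw [show s + 1 - (t + 1) = s - t by ring] at h3
  rw [show s - 1 - (t - 1) = s - t by ring] at h4
  unfold smoothProj
  rw [add_zero, add_zero, Real.sqrt_sq_eq_abs, Real.sqrt_sq_eq_abs]
  rw [abs_le] at *
  constructor <;> linarith

theorem hasDerivAt_sqrt_sq_add {ε : ℝ} (hε : 0 < ε) (c s : ℝ) :
    HasDerivAt (fun s => √((s + c) ^ 2 + ε)) ((s + c) / √((s + c) ^ 2 + ε)) s := by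
  have h1 : HasDerivAt (fun s : ℝ => (s + c) ^ 2 + ε) (2 * (s + c)) s := by
    simpa using (((hasDerivAt_id s).add_const c).pow 2).add_const ε
  refine (h1.sqrt (by positivity)).congr_deriv ?_
  rw [mul_div_mul_left _ _ two_ne_zero]

theorem deriv_smoothProj {ε : ℝ} (hε : 0 < ε) (s : ℝ) : deriv (smoothProj ε) s =
    ((s + 1) / √((s + 1) ^ 2 + ε) - (s - 1) / √((s - 1) ^ 2 + ε)) / 2 := by
  have h := ((hasDerivAt_sqrt_sq_add hε 1 s).sub (hasDerivAt_sqrt_sq_add hε (-1) s)).div_const 2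
  exact h.deriv

/-- The Newton remainder of `√(s² + ε)` as a smoothing of `|s|`: it is of order `√ε` up to a
superlinear term, except close to the kink. -/
theorem abs_sub_sqrt_remainder_le {ε δ : ℝ} (hε : 0 < ε) (hδ : 0 < δ) (z s : ℝ) :
    |(|z| - √(s ^ 2 + ε) - s / √(s ^ 2 + ε) * (z - s))| ≤
      3 * √ε + 4 * (|z - s| * {w : ℝ | 0 < |w| ∧ |w| < δ}.indicator 1 z)
        + 8 / δ * (z - s) ^ 2 := by
  have hsq : 0 < s ^ 2 + ε := by positivity
  set h := √(s ^ 2 + ε) with hh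
  have hpos : 0 < h := Real.sqrt_pos.2 hsq
  have h2 : h ^ 2 = s ^ 2 + ε := Real.sq_sqrt hsq.le
  have hr0 : 0 < √ε := Real.sqrt_pos.2 hε
  have hr2 : √ε ^ 2 = ε := Real.sq_sqrt hε.le
  have hsh : |s| ≤ h := Real.abs_le_sqrt (by linarith)
  have hhr : h - |s| ≤ √ε := (abs_le.1 (abs_sqrt_sub_abs_le hε.le s)).2
  have hrh : √ε ≤ h := Real.sqrt_le_sqrt (by nlinarith)
  -- By h² = s² + ε the remainder separates into a term ε/h ≤ √ε and the error |z| - sz/h of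
  -- replacing the sign of z by s/h.
  have e1 : |z| - h - s / h * (z - s) = (|z| - s * z / h) - ε / h := by
    field_simp; nlinarith
  have e2 : |ε / h| ≤ √ε := by
    rw [abs_of_pos (by positivity), div_le_iff₀ hpos]
    nlinarith
  have hI : 0 ≤ {w : ℝ | 0 < |w| ∧ |w| < δ}.indicator (1 : ℝ → ℝ) z :=
    Set.indicator_nonneg (fun _ _ => zero_le_one) z
  have hq : 0 ≤ 8 / δ * (z - s) ^ 2 := by positivity
  have key : |(|z| - s * z / h)| ≤ 2 * √ε + 4 * (|z - s| * {w : ℝ | 0 < |w| ∧ |w| < δ}.indicator 1 z)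
        + 8 / δ * (z - s) ^ 2 := by
    -- If |z| ≤ 2|z - s|, the error is at most 2|z| ≤ 4|z - s|: it is zero for z = 0, falls under
    -- the indicator for 0 < |z| < δ, and is quadratic for |z| ≥ δ because then |z - s| ≥ δ/2.
    -- Otherwise s has the sign of z and |z| ≤ 2|s| ≤ 2h, so h - |s| ≤ √ε bounds the error by 2√ε.
    rcases le_or_gt |z| (2 * |z - s|) with hc | hc
    · have b1 : |(|z| - s * z / h)| ≤ 2 * |z| := by
        refine (abs_sub _ _).trans ?_
        rw [abs_abs, abs_div, abs_mul, abs_of_pos hpos]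
        have : |s| * |z| / h ≤ |z| := by
          rw [div_le_iff₀ hpos, mul_comm]; gcongr
        linarith
      by_cases hz : 0 < |z| ∧ |z| < δ
      · rw [Set.indicator_of_mem (show z ∈ {w : ℝ | 0 < |w| ∧ |w| < δ} from hz)]
        simp only [Pi.one_apply, mul_one]
        linarith
      · rcases eq_or_lt_of_le (abs_nonneg z) with hz0 | hz0
        · have := mul_nonneg (abs_nonneg (z - s)) hI
          linarith
        · have hzδ : δ ≤ |z| := by
            by_contra hcon
            exact hz ⟨hz0, not_le.1 hcon⟩
          have b2 : 4 * |z - s| ≤ 8 / δ * (z - s) ^ 2 := by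
            rw [div_mul_eq_mul_div, le_div_iff₀ hδ, ← sq_abs (z - s)]
            nlinarith [abs_nonneg (z - s)]
          have := mul_nonneg (abs_nonneg (z - s)) hI
          linarith
    · have hzs : |z| ≤ 2 * |s| := by
        have := abs_sub_abs_le_abs_sub z s
        linarith
      have hmul : s * z = |s| * |z| := by
        rw [← abs_mul, eq_comm, abs_eq_self]
        have h5 : |z - s| ^ 2 ≤ |z| ^ 2 :=
          pow_le_pow_left₀ (abs_nonneg _) (by linarith [abs_nonneg (z - s)]) 2
        rw [sq_abs, sq_abs] at h5
        nlinarith [sq_nonneg s]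
      rw [hmul]
      have e3 : |z| - |s| * |z| / h = |z| * (h - |s|) / h := by field_simp
      rw [e3, abs_of_nonneg (div_nonneg (mul_nonneg (abs_nonneg _) (by linarith)) hpos.le)]
      have b3 : |z| * (h - |s|) / h ≤ 2 * √ε := by
        rw [div_le_iff₀ hpos]
        have : |z| * (h - |s|) ≤ (2 * h) * √ε := by
          gcongr
          · linarith
        linarith
      have := mul_nonneg (abs_nonneg (z - s)) hI
      linarith
  rw [e1]
  refine (abs_sub _ _).trans ?_
  linarith

/-- The Newton remainder of the smoothed projection. -/
theorem abs_smoothProj_remainder_le {ε δ : ℝ} (hε : 0 < ε) (hδ : 0 < δ) (z s : ℝ) :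
    |smoothProj 0 z - smoothProj ε s - deriv (smoothProj ε) s * (z - s)| ≤
      3 * √ε + 2 * (|z - s| * {w : ℝ | 0 < |w| ∧ |w| < δ}.indicator 1 (z + 1))
        + 2 * (|z - s| * {w : ℝ | 0 < |w| ∧ |w| < δ}.indicator 1 (z - 1))
        + 8 / δ * (z - s) ^ 2 := by
  have h1 := abs_sub_sqrt_remainder_le hε hδ (z + 1) (s + 1)
  have h2 := abs_sub_sqrt_remainder_le hε hδ (z - 1) (s - 1)
  rw [deriv_smoothProj hε]
  unfold smoothProj
  rw [add_zero, add_zero, Real.sqrt_sq_eq_abs, Real.sqrt_sq_eq_abs]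
  rw [show z + 1 - (s + 1) = z - s by ring] at h1
  rw [show z - 1 - (s - 1) = z - s by ring] at h2
  set a := (s + 1) / √((s + 1) ^ 2 + ε)
  set b := (s - 1) / √((s - 1) ^ 2 + ε)
  rw [abs_le] at *
  constructor <;> linarith

/-! ### Taylor bounds for φ and smallness of the near-kink sets -/

/-- First-order Taylor estimate for a function with Lipschitz derivative. -/
theorem abs_taylor_remainder_le {f : ℝ → ℝ} (hf : Differentiable ℝ f) {s : Set ℝ}
    (hs : Convex ℝ s) {K : ℝ≥0} (hK : LipschitzOnWith K (deriv f) s) {a b : ℝ} (ha : a ∈ s)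
    (hb : b ∈ s) : |f a - f b - deriv f b * (a - b)| ≤ K * (a - b) ^ 2 := by
  have hsub : Set.uIcc b a ⊆ s := hs.ordConnected.uIcc_subset hb ha
  have h := Convex.norm_image_sub_le_of_norm_hasDerivWithin_le (𝕜 := ℝ)
    (f := fun t => f t - deriv f b * t) (f' := fun t => deriv f t - deriv f b)
    (s := Set.uIcc b a) (C := K * |a - b|) (x := b) (y := a)
    (fun t _ => ((hf t).hasDerivAt.sub (((hasDerivAt_id t).const_mul (deriv f b)).congr_deriv
      (mul_one _))).hasDerivWithinAt)
    (fun t ht => by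
      refine (hK.norm_sub_le (hsub ht) hb).trans ?_
      have : |t - b| ≤ |a - b| := Set.abs_sub_left_of_mem_uIcc ht
      exact mul_le_mul_of_nonneg_left this K.2)
    (convex_uIcc b a) Set.left_mem_uIcc Set.right_mem_uIcc
  rw [Real.norm_eq_abs, Real.norm_eq_abs, mul_assoc, ← sq, sq_abs] at h
  convert h using 2
  ring

/-- Lipschitz and Taylor bounds for the nonlinearity on bounded sets. -/
theorem Problem.exists_phi_bounds {n : ℕ} (P : Problem n) (M : ℝ) : ∃ C : ℝ, 0 ≤ C ∧
    ∀ a b : ℝ, |a| ≤ M → |b| ≤ M →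
      |deriv P.φ a| ≤ C ∧ |P.φ a - P.φ b| ≤ C * |a - b| ∧
      |deriv P.φ a - deriv P.φ b| ≤ C * |a - b| ∧
      |P.φ a - P.φ b - deriv P.φ b * (a - b)| ≤ C * (a - b) ^ 2 ∧
      |deriv P.φ a - deriv P.φ b - deriv (deriv P.φ) b * (a - b)| ≤ C * (a - b) ^ 2 := by
  have hc : IsCompact (Set.Icc (-M) M) := isCompact_Icc
  have hconv : Convex ℝ (Set.Icc (-M) M) := convex_Icc _ _
  have hd2 : ContDiff ℝ 1 (deriv P.φ) :=
    ((contDiff_succ_iff_deriv (n := 1)).1 (by simpa [one_add_one_eq_two] using P.φ_contDiff)).2.2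
  obtain ⟨B, hB⟩ := hc.exists_bound_of_continuousOn P.continuous_deriv_phi.continuousOn
  have hl : ∀ {g : ℝ → ℝ}, LocallyLipschitz g → ∃ K, LipschitzOnWith K g (Set.Icc (-M) M) :=
    fun hg => hg.locallyLipschitzOn.exists_lipschitzOnWith_of_compact hc
  obtain ⟨K0, h0⟩ := hl (P.φ_contDiff.of_le (by norm_num)).locallyLipschitz
  obtain ⟨K1, h1⟩ := hl hd2.locallyLipschitz
  obtain ⟨K2, h2⟩ := hl P.φ_lip
  refine ⟨|B| + K0 + K1 + K2, by positivity, fun a b ha hb => ?_⟩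
  have ha' : a ∈ Set.Icc (-M) M := abs_le.1 ha
  have hb' : b ∈ Set.Icc (-M) M := abs_le.1 hb
  have hk0 := K0.2
  have hk1 := K1.2
  have hk2 := K2.2
  have hB0 := abs_nonneg B
  refine ⟨?_, ?_, ?_, ?_, ?_⟩
  · have := hB a ha'
    rw [Real.norm_eq_abs] at this
    have := le_abs_self B
    simp only [NNReal.val_eq_coe] at *
    linarith
  · refine (h0.norm_sub_le ha' hb').trans ?_
    rw [Real.norm_eq_abs]
    gcongr
    simp only [NNReal.val_eq_coe] at *
    linarith
  · refine (h1.norm_sub_le ha' hb').trans ?_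
    rw [Real.norm_eq_abs]
    gcongr
    simp only [NNReal.val_eq_coe] at *
    linarith
  · refine (abs_taylor_remainder_le (P.φ_contDiff.differentiable (by norm_num)) hconv h1
      ha' hb').trans ?_
    gcongr
    simp only [NNReal.val_eq_coe] at *
    linarith
  · refine (abs_taylor_remainder_le (hd2.differentiable (by norm_num)) hconv h2
      ha' hb').trans ?_
    gcongr
    simp only [NNReal.val_eq_coe] at *
    linarith

/-- For a measurable function on a finite measure space, the set where it is small but nonzero
has small measure. -/
theorem exists_measure_small_ne_zero {α : Type*} [MeasurableSpace α] {μ : Measure α}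
    [IsFiniteMeasure μ] {f : α → ℝ} (hf : Measurable f) {η : ℝ≥0∞} (hη : 0 < η) :
    ∃ δ : ℝ, 0 < δ ∧ ∀ δ' : ℝ, 0 < δ' → δ' ≤ δ → μ {x | 0 < |f x| ∧ |f x| < δ'} < η := by
  have hmeas : ∀ d : ℝ, MeasurableSet {x | 0 < |f x| ∧ |f x| < d} := fun d =>
    (measurableSet_lt measurable_const hf.norm).inter (measurableSet_lt hf.norm measurable_const)
  -- These sets decrease to the empty set only because the zeros of f, which may have positive
  -- measure, are excluded.
  have h := tendsto_measure_iInter_atTop (μ := μ)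
    (s := fun k : ℕ => {x | 0 < |f x| ∧ |f x| < 1 / ((k : ℝ) + 1)})
    (fun k => (hmeas _).nullMeasurableSet)
    (fun i j hij x hx => ⟨hx.1, hx.2.trans_le (one_div_le_one_div_of_le (by positivity)
      (by have : (i : ℝ) ≤ j := by exact_mod_cast hij
          linarith))⟩) ⟨0, measure_ne_top _ _⟩
  have hempty : (⋂ k : ℕ, {x | 0 < |f x| ∧ |f x| < 1 / ((k : ℝ) + 1)}) = ∅ := by
    refine Set.eq_empty_of_forall_notMem fun x hx => ?_
    rw [Set.mem_iInter] at hx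
    obtain ⟨k, hk⟩ := exists_nat_one_div_lt (hx 0).1
    exact lt_asymm hk (hx k).2
  rw [hempty, measure_empty] at h
  obtain ⟨k, hk⟩ := (h.eventually (gt_mem_nhds hη)).exists
  refine ⟨1 / ((k : ℝ) + 1), by positivity, fun δ' _ hle => lt_of_le_of_lt (measure_mono ?_) hk⟩
  exact fun x hx => ⟨hx.1, hx.2.trans_le hle⟩

/-! ### L² estimates from the Sobolev embedding -/

namespace Problem

variable {n : ℕ} (P : Problem n)

theorem exists_sobolev_norm (hn : n = 2 ∨ n = 3) : ∃ S : ℝ≥0, ∀ u : H10 P.Ω,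
    eLpNorm (embed P.Ω u) 6 (dom P.Ω) ≤ S * ENNReal.ofReal ‖u‖ := by
  obtain ⟨S, hS⟩ := exists_sobolev hn P.isOpen P.isBounded
  refine ⟨S, fun u => (hS u).trans ?_⟩
  rw [← Lp.enorm_def, ← ofReal_norm]
  gcongr
  exact norm_grad_le u

/-- Squares of elements of `H¹₀(Ω)` lie in `L²(Ω)`. -/
theorem exists_sq (hn : n = 2 ∨ n = 3) : ∃ K : ℝ, 0 ≤ K ∧ ∀ u : H10 P.Ω,
    ∃ q : Lp ℝ 2 (dom P.Ω), (q =ᵐ[dom P.Ω] fun x => embed P.Ω u x ^ 2) ∧ ‖q‖ ≤ K * ‖u‖ ^ 2 := by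
  obtain ⟨S, hS⟩ := P.exists_sobolev_norm hn
  -- The L² norm of u² is the square of the L⁴ norm of u, and c is the Hölder constant from L⁶ to L⁴
  -- on a set of finite measure.
  set c := dom P.Ω Set.univ ^ (1 / (4 : ℝ≥0∞).toReal - 1 / (6 : ℝ≥0∞).toReal)
  have hc : c ≠ ⊤ := ENNReal.rpow_ne_top_of_nonneg (by norm_num) (measure_ne_top _ _)
  refine ⟨(S * c.toReal) ^ 2, by positivity, fun u => ?_⟩
  have h1 : eLpNorm (fun x => embed P.Ω u x ^ 2) 2 (dom P.Ω) ≤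
      (S * ENNReal.ofReal ‖u‖ * c) ^ (2 : ℝ) := by
    have e1 : eLpNorm (fun x => embed P.Ω u x ^ 2) 2 (dom P.Ω)
        = eLpNorm (embed P.Ω u) 4 (dom P.Ω) ^ (2 : ℝ) := by
      have h := eLpNorm_norm_rpow (p := 2) (q := 2) (μ := dom P.Ω) (embed P.Ω u) (by norm_num)
      have e4 : (2 : ℝ≥0∞) * ENNReal.ofReal 2 = 4 := by norm_num
      rw [e4] at h
      rw [← h]
      congr 1
      ext x
      simp
    rw [e1]
    gcongr
    refine (eLpNorm_le_eLpNorm_mul_rpow_measure_univ (p := 4) (q := 6) (by norm_num)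
      (Lp.aestronglyMeasurable _)).trans ?_
    gcongr
    exact hS u
  have htop : (S * ENNReal.ofReal ‖u‖ * c) ^ (2 : ℝ) ≠ ⊤ :=
    ENNReal.rpow_ne_top_of_nonneg (by norm_num)
      (ENNReal.mul_ne_top (ENNReal.mul_ne_top ENNReal.coe_ne_top ENNReal.ofReal_ne_top) hc)
  have hm : MemLp (fun x => embed P.Ω u x ^ 2) 2 (dom P.Ω) :=
    ⟨(Lp.aestronglyMeasurable _).pow 2, h1.trans_lt htop.lt_top⟩
  refine ⟨hm.toLp _, hm.coeFn_toLp, ?_⟩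
  rw [Lp.norm_toLp]
  refine (ENNReal.toReal_mono htop h1).trans_eq ?_
  rw [← ENNReal.toReal_rpow, ENNReal.toReal_mul, ENNReal.toReal_mul,
    ENNReal.toReal_ofReal (norm_nonneg _), Real.rpow_two, ENNReal.coe_toReal]
  ring

/-- The restriction of an element of `H¹₀(Ω)` to a small set is small in `L²(Ω)`. -/
theorem exists_indicator (hn : n = 2 ∨ n = 3) : ∃ K : ℝ, 0 ≤ K ∧ ∀ (u : H10 P.Ω)
    (s : Set (EuclideanSpace ℝ (Fin n))), MeasurableSet s →
    ∃ r : Lp ℝ 2 (dom P.Ω), (r =ᵐ[dom P.Ω] fun x => |embed P.Ω u x| * s.indicator 1 x) ∧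
      ‖r‖ ≤ K * ‖u‖ * (dom P.Ω).real s ^ (1 / 3 : ℝ) := by
  obtain ⟨S, hS⟩ := P.exists_sobolev_norm hn
  refine ⟨S, S.2, fun u s hs => ?_⟩
  have hmeas : AEStronglyMeasurable (fun x => |embed P.Ω u x| * s.indicator (1 : EuclideanSpace ℝ (Fin n) → ℝ) x)
      (dom P.Ω) := by
    have h := (Lp.aestronglyMeasurable (embed P.Ω u)).norm
    exact h.mul ((measurable_one.indicator hs).aestronglyMeasurable)
  have h1 : eLpNorm (fun x => |embed P.Ω u x| * s.indicator (1 : EuclideanSpace ℝ (Fin n) → ℝ) x) 2 (dom P.Ω) ≤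
      S * ENNReal.ofReal ‖u‖ * dom P.Ω s ^ (1 / 3 : ℝ) := by
    refine (eLpNorm_two_le_of_support (s := s) hmeas ?_).trans ?_
    · intro x hx
      by_contra hcon
      exact hx (by simp [hcon])
    · gcongr
      refine le_trans (eLpNorm_mono fun x => ?_) (hS u)
      by_cases hx : x ∈ s <;> simp [hx]
  have htop : S * ENNReal.ofReal ‖u‖ * dom P.Ω s ^ (1 / 3 : ℝ) ≠ ⊤ :=
    ENNReal.mul_ne_top (ENNReal.mul_ne_top ENNReal.coe_ne_top ENNReal.ofReal_ne_top)
      (ENNReal.rpow_ne_top_of_nonneg (by norm_num) (measure_ne_top _ _))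
  have hm : MemLp (fun x => |embed P.Ω u x| * s.indicator (1 : EuclideanSpace ℝ (Fin n) → ℝ) x) 2 (dom P.Ω) :=
    ⟨hmeas, h1.trans_lt htop.lt_top⟩
  refine ⟨hm.toLp _, hm.coeFn_toLp, ?_⟩
  rw [Lp.norm_toLp]
  refine (ENNReal.toReal_mono htop h1).trans_eq ?_
  rw [ENNReal.toReal_mul, ENNReal.toReal_mul, ← ENNReal.toReal_rpow,
    ENNReal.toReal_ofReal (norm_nonneg _), ENNReal.coe_toReal]
  rfl

end Problem

/-- Four terms are what the projection remainder requires; the other uses pad with zero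
coefficients. -/
theorem norm_le_of_ae_abs_le {α : Type*} [MeasurableSpace α] {μ : Measure α}
    {f g₁ g₂ g₃ g₄ : Lp ℝ 2 μ} {a b c d : ℝ} (ha : 0 ≤ a) (hb : 0 ≤ b) (hc : 0 ≤ c) (hd : 0 ≤ d)
    (h : ∀ᵐ x ∂μ, |f x| ≤ a * |g₁ x| + b * |g₂ x| + c * |g₃ x| + d * |g₄ x|) :
    ‖f‖ ≤ a * ‖g₁‖ + b * ‖g₂‖ + c * ‖g₃‖ + d * ‖g₄‖ := by
  have hn : ∀ {r : ℝ} (_ : 0 ≤ r) (g : Lp ℝ 2 μ), ‖r • |g|‖ = r * ‖g‖ := fun hr g => by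
    rw [norm_smul, norm_abs_eq_norm, Real.norm_of_nonneg hr]
  rw [← hn ha, ← hn hb, ← hn hc, ← hn hd]
  refine le_trans (Lp.norm_le_norm_of_ae_le ?_)
    ((norm_add_le (a • |g₁| + b • |g₂| + c • |g₃|) (d • |g₄|)).trans
      (add_le_add ((norm_add_le _ _).trans (add_le_add (norm_add_le _ _) le_rfl)) le_rfl))
  filter_upwards [h, Lp.coeFn_add (a • |g₁| + b • |g₂| + c • |g₃|) (d • |g₄|),
    Lp.coeFn_add (a • |g₁| + b • |g₂|) (c • |g₃|), Lp.coeFn_add (a • |g₁|) (b • |g₂|),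
    Lp.coeFn_smul a |g₁|, Lp.coeFn_smul b |g₂|, Lp.coeFn_smul c |g₃|, Lp.coeFn_smul d |g₄|,
    Lp.coeFn_abs g₁, Lp.coeFn_abs g₂, Lp.coeFn_abs g₃, Lp.coeFn_abs g₄]
    with x h0 h1 h2 h3 h4 h5 h6 h7 h8 h9 h10 h11
  rw [h1, Pi.add_apply, h2, Pi.add_apply, h3, Pi.add_apply, h4, h5, h6, h7, Pi.smul_apply,
    Pi.smul_apply, Pi.smul_apply, Pi.smul_apply, h8, h9, h10, h11]
  exact h0.trans (le_abs_self _)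

theorem norm_toLp_le_add {G H : Type*} [NormedAddCommGroup G] [NormedAddCommGroup H]
    (a : G) (b : H) : ‖(WithLp.toLp 2 (a, b) : WithLp 2 (G × H))‖ ≤ ‖a‖ + ‖b‖ := by
  refine abs_le_of_sq_le_sq' ?_ (by positivity) |>.2
  rw [WithLp.prod_norm_sq_eq_of_L2]
  change ‖a‖ ^ 2 + ‖b‖ ^ 2 ≤ _
  nlinarith [norm_nonneg a, norm_nonneg b]

/-! ### Continuity of F and its Newton remainder -/

namespace Problem

variable {n : ℕ} {P : Problem n}

/-- Both components of `x` are bounded by `M` almost everywhere. -/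
def Bdd.BoundedBy (x : P.Bdd) (M : ℝ) : Prop :=
  ∀ᵐ t ∂(dom P.Ω), |embed P.Ω x.y t| ≤ M ∧ |embed P.Ω x.p t| ≤ M

theorem Bdd.norm_y_sub_le (x z : P.Bdd) : ‖x.y - z.y‖ ≤ ‖x.1 - z.1‖ :=
  WithLp.norm_fst_le _ (x.1 - z.1)

theorem Bdd.norm_p_sub_le (x z : P.Bdd) : ‖x.p - z.p‖ ≤ ‖x.1 - z.1‖ :=
  WithLp.norm_snd_le _ (x.1 - z.1)

theorem embed_sub_ae (u v : H10 P.Ω) :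
    embed P.Ω (u - v) =ᵐ[dom P.Ω] fun t => embed P.Ω u t - embed P.Ω v t := by
  rw [map_sub]; exact Lp.coeFn_sub _ _

variable (P)

theorem F_sub (x z : P.Bdd) (ε : ℝ) : P.F z 0 - P.F x ε = WithLp.toLp 2
    (P.A (z.y - x.y) + gelfand P.Ω (P.toL2 z.phiY - P.toL2 x.phiY + (1 / P.nu) •
        (embed P.Ω (z.p - x.p) + P.mu • (P.toL2 (z.projP 0) - P.toL2 (x.projP ε)))),
      P.A (z.p - x.p) + gelfand P.Ω (mulL z.dphiY (embed P.Ω z.p) - mulL x.dphiY (embed P.Ω x.p)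
        - embed P.Ω (z.y - x.y))) := by
  unfold F
  rw [← WithLp.toLp_sub, Prod.mk_sub_mk]
  congr 2
  · simp only [map_sub, map_add, map_smul, smul_add, smul_sub]; abel
  · simp only [map_sub, map_add]; abel

/-- Lipschitz dependence of `F` on bounded sets, and continuity at `ε = 0`. -/
theorem exists_norm_F_sub_le (M : ℝ) : ∃ C : ℝ, ∀ (ε : ℝ), 0 ≤ ε → ∀ x z : P.Bdd,
    x.BoundedBy M → z.BoundedBy M → ‖P.F z 0 - P.F x ε‖ ≤ C * (‖z.1 - x.1‖ + √ε) := by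
  obtain ⟨C, hC, hφ⟩ := P.exists_phi_bounds M
  set one := Lp.const 2 (dom P.Ω) (1 : ℝ)
  have hmu := P.mu_pos
  have hnu := P.nu_pos
  set Kg := ‖gelfand P.Ω‖
  set N := C + 1 / P.nu * (1 + P.mu * (1 / P.mu + ‖one‖)) + (C * |M| + C + 1)
  refine ⟨2 * ‖P.A‖ + Kg * N, fun ε hε x z hx hz => ?_⟩
  set d := ‖z.1 - x.1‖
  have hr : 0 ≤ √ε := Real.sqrt_nonneg ε
  have hdy : ‖z.y - x.y‖ ≤ d := z.norm_y_sub_le x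
  have hdp : ‖z.p - x.p‖ ≤ d := z.norm_p_sub_le x
  have hedy := (norm_embed_le (z.y - x.y)).trans hdy
  have hedp := (norm_embed_le (z.p - x.p)).trans hdp
  have hd0 : 0 ≤ d := norm_nonneg _
  have b1 : ‖P.toL2 z.phiY - P.toL2 x.phiY‖ ≤ C * ‖embed P.Ω (z.y - x.y)‖ := by
    refine Lp.norm_le_mul_norm_of_ae_le_mul ?_
    filter_upwards [Lp.coeFn_sub (P.toL2 z.phiY) (P.toL2 x.phiY), P.toL2_ae z.phiY,
      P.toL2_ae x.phiY, z.phiY_ae, x.phiY_ae, embed_sub_ae z.y x.y, hx, hz]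
      with t h1 h2 h3 h4 h5 h6 h7 h8
    rw [h1, Pi.sub_apply, h2, h3, h4, h5, h6]
    exact (hφ _ _ h8.1 h7.1).2.1
  have b2 : ‖P.toL2 (z.projP 0) - P.toL2 (x.projP ε)‖ ≤
      1 / P.mu * ‖embed P.Ω (z.p - x.p)‖ + √ε * ‖one‖ + 0 * ‖one‖ + 0 * ‖one‖ := by
    refine norm_le_of_ae_abs_le (by positivity) hr le_rfl le_rfl ?_
    filter_upwards [Lp.coeFn_sub (P.toL2 (z.projP 0)) (P.toL2 (x.projP ε)), P.toL2_ae (z.projP 0),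
      P.toL2_ae (x.projP ε), z.projP_ae 0, x.projP_ae ε, embed_sub_ae z.p x.p,
      Lp.coeFn_const (p := 2) (μ := dom P.Ω) (c := (1 : ℝ))] with t h1 h2 h3 h4 h5 h6 h7
    rw [h1, Pi.sub_apply, h2, h3, h4, h5, h6, h7, abs_sub_comm]
    refine (abs_smoothProj_sub_le hε _ _).trans_eq ?_
    have e : -(embed P.Ω x.p t) / P.mu - -(embed P.Ω z.p t) / P.mu =
        1 / P.mu * (embed P.Ω z.p t - embed P.Ω x.p t) := by ring
    rw [e, abs_mul, abs_of_pos (one_div_pos.2 hmu)]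
    simp
  have b3 : ‖mulL z.dphiY (embed P.Ω z.p) - mulL x.dphiY (embed P.Ω x.p)‖ ≤
      (C * |M|) * ‖embed P.Ω (z.y - x.y)‖ + C * ‖embed P.Ω (z.p - x.p)‖
        + 0 * ‖one‖ + 0 * ‖one‖ := by
    refine norm_le_of_ae_abs_le (by positivity) hC le_rfl le_rfl ?_
    filter_upwards [Lp.coeFn_sub (mulL z.dphiY (embed P.Ω z.p)) (mulL x.dphiY (embed P.Ω x.p)),
      mulL_ae z.dphiY (embed P.Ω z.p), mulL_ae x.dphiY (embed P.Ω x.p), z.dphiY_ae, x.dphiY_ae,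
      embed_sub_ae z.y x.y, embed_sub_ae z.p x.p, hx, hz]
      with t h1 h2 h3 h4 h5 h6 h7 h8 h9
    rw [h1, Pi.sub_apply, h2, h3, h4, h5, h6, h7]
    have k1 := (hφ _ _ h9.1 h8.1).2.2.1
    have k2 := (hφ _ _ h8.1 h9.1).1
    have e : deriv P.φ (embed P.Ω z.y t) * embed P.Ω z.p t
        - deriv P.φ (embed P.Ω x.y t) * embed P.Ω x.p t =
        (deriv P.φ (embed P.Ω z.y t) - deriv P.φ (embed P.Ω x.y t)) * embed P.Ω z.p t
        + deriv P.φ (embed P.Ω x.y t) * (embed P.Ω z.p t - embed P.Ω x.p t) := by ring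
    rw [e]
    refine (abs_add_le _ _).trans ?_
    rw [abs_mul, abs_mul]
    have k3 : |embed P.Ω z.p t| ≤ |M| := h9.2.trans (le_abs_self M)
    calc _ ≤ C * |embed P.Ω z.y t - embed P.Ω x.y t| * |M|
          + C * |embed P.Ω z.p t - embed P.Ω x.p t| := by gcongr
      _ = _ := by ring
  rw [F_sub]
  refine (norm_toLp_le_add _ _).trans ?_
  -- From here every bound is weakened to a multiple of d + √ε, so that the coefficients simply add
  -- up to 2‖A‖ + Kg N.
  have c1 : ‖P.toL2 z.phiY - P.toL2 x.phiY + (1 / P.nu) •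
        (embed P.Ω (z.p - x.p) + P.mu • (P.toL2 (z.projP 0) - P.toL2 (x.projP ε)))‖ ≤
      C * (d + √ε) + 1 / P.nu * ((d + √ε) + P.mu * (1 / P.mu * (d + √ε) + (d + √ε) * ‖one‖)) := by
    refine (norm_add_le _ _).trans (add_le_add (b1.trans ?_) ?_)
    · gcongr; linarith
    · rw [norm_smul, Real.norm_of_nonneg (by positivity)]
      gcongr
      refine (norm_add_le _ _).trans (add_le_add (by linarith) ?_)
      rw [norm_smul, Real.norm_of_nonneg hmu.le]
      gcongr
      refine b2.trans ?_
      rw [zero_mul, add_zero, add_zero]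
      gcongr <;> linarith
  have c2 : ‖mulL z.dphiY (embed P.Ω z.p) - mulL x.dphiY (embed P.Ω x.p)
        - embed P.Ω (z.y - x.y)‖ ≤ (C * |M|) * (d + √ε) + C * (d + √ε) + (d + √ε) := by
    refine (norm_sub_le _ _).trans (add_le_add (b3.trans ?_) (by linarith))
    rw [zero_mul, add_zero, add_zero]
    gcongr <;> linarith
  have a1 : ‖P.A (z.y - x.y)‖ ≤ ‖P.A‖ * (d + √ε) :=
    (P.A.le_opNorm _).trans (by gcongr; linarith)
  have a2 : ‖P.A (z.p - x.p)‖ ≤ ‖P.A‖ * (d + √ε) :=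
    (P.A.le_opNorm _).trans (by gcongr; linarith)
  calc _ ≤ (‖P.A‖ * (d + √ε) + Kg * (C * (d + √ε) + 1 / P.nu *
            ((d + √ε) + P.mu * (1 / P.mu * (d + √ε) + (d + √ε) * ‖one‖))))
        + (‖P.A‖ * (d + √ε) + Kg * ((C * |M|) * (d + √ε) + C * (d + √ε) + (d + √ε))) := by
        refine add_le_add ((norm_add_le _ _).trans (add_le_add a1 ?_))
          ((norm_add_le _ _).trans (add_le_add a2 ?_))
        · exact ((gelfand P.Ω).le_opNorm _).trans (by gcongr)
        · exact ((gelfand P.Ω).le_opNorm _).trans (by gcongr)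
    _ = _ := by simp only [N]; ring

/-- The three Newton remainders represent `∂F/∂x (x, ε) (z - x)` if `z` solves the limit system
and `x` the smoothed one. -/
theorem dF_sub_eq {ε : ℝ} (hε : 0 < ε) (x z : P.Bdd) (hx : P.F x ε = 0) (hz : P.F z 0 = 0) :
    P.dF x hε (z.1 - x.1) = -WithLp.toLp 2
      (gelfand P.Ω ((P.toL2 z.phiY - P.toL2 x.phiY - mulL x.dphiY (embed P.Ω (z.y - x.y)))
        + (P.mu / P.nu) • (P.toL2 (z.projP 0) - P.toL2 (x.projP ε)
          + (1 / P.mu) • mulL (x.dprojP hε) (embed P.Ω (z.p - x.p)))),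
       gelfand P.Ω (mulL z.dphiY (embed P.Ω z.p) - mulL x.dphiY (embed P.Ω x.p)
        - mulL x.ddphiYP (embed P.Ω (z.y - x.y)) - mulL x.dphiY (embed P.Ω (z.p - x.p)))) := by
  -- Subtracting this zero turns the derivative into minus the Newton remainder: A and the identity
  -- terms cancel by linearity. The inner derivative -1/μ of -p/μ explains the plus sign before the
  -- term with P_ε'.
  have h0 : P.F z 0 - P.F x ε = 0 := by rw [hx, hz, sub_zero]
  have key : P.dF x hε (z.1 - x.1) - (P.F z 0 - P.F x ε) = -WithLp.toLp 2
      (gelfand P.Ω ((P.toL2 z.phiY - P.toL2 x.phiY - mulL x.dphiY (embed P.Ω (z.y - x.y)))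
        + (P.mu / P.nu) • (P.toL2 (z.projP 0) - P.toL2 (x.projP ε)
          + (1 / P.mu) • mulL (x.dprojP hε) (embed P.Ω (z.p - x.p)))),
       gelfand P.Ω (mulL z.dphiY (embed P.Ω z.p) - mulL x.dphiY (embed P.Ω x.p)
        - mulL x.ddphiYP (embed P.Ω (z.y - x.y)) - mulL x.dphiY (embed P.Ω (z.p - x.p)))) := by
    have hd : P.dF x hε (z.1 - x.1) = WithLp.toLp 2
        (P.A (z.y - x.y) + mulOp x.dphiY (z.y - x.y)
          + (1 / P.nu) • (P.idOp (z.p - x.p) - mulOp (x.dprojP hε) (z.p - x.p)),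
         mulOp x.ddphiYP (z.y - x.y) - P.idOp (z.y - x.y)
          + (P.A (z.p - x.p) + mulOp x.dphiY (z.p - x.p))) := rfl
    have m : ∀ (b : Lp ℝ ∞ (dom P.Ω)) (u : H10 P.Ω),
        mulOp b u = gelfand P.Ω (mulL b (embed P.Ω u)) := fun _ _ => rfl
    have i : ∀ u : H10 P.Ω, P.idOp u = gelfand P.Ω (embed P.Ω u) := fun _ => rfl
    have hmu := P.mu_pos.ne'
    have e1 : P.mu / P.nu * (1 / P.mu) = 1 / P.nu := by field_simp
    have e2 : 1 / P.nu * P.mu = P.mu / P.nu := by ring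
    rw [hd, F_sub, ← WithLp.toLp_sub, ← WithLp.toLp_neg, Prod.mk_sub_mk, Prod.neg_mk]
    congr 2
    · simp only [m, i]
      simp only [(gelfand P.Ω).map_sub, (gelfand P.Ω).map_add, (gelfand P.Ω).map_smul, smul_add,
        smul_sub, smul_smul, e1, e2]
      abel
    · simp only [m, i]
      simp only [(gelfand P.Ω).map_sub]
      abel
  rw [← key, h0, sub_zero]

end Problem

/-- L² convergence yields an almost everywhere convergent sequence, along which the bound persists.
This puts the limit of the solutions in L^∞, where F is defined. -/
theorem ae_abs_le_of_tendsto {α ι : Type*} [MeasurableSpace α] {μ : Measure α} {l : Filter ι}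
    [l.NeBot] [l.IsCountablyGenerated] {u : ι → Lp ℝ 2 μ} {v : Lp ℝ 2 μ} {M : ℝ}
    (hlim : Tendsto u l (𝓝 v)) (hM : ∀ᶠ i in l, ∀ᵐ x ∂μ, |u i x| ≤ M) : ∀ᵐ x ∂μ, |v x| ≤ M := by
  obtain ⟨ns, hns, hae⟩ := (tendstoInMeasure_of_tendsto_Lp hlim).exists_seq_tendsto_ae'
  obtain ⟨N, hN⟩ := eventually_atTop.1 (hns.eventually hM)
  have hN' : ∀ᵐ x ∂μ, ∀ k, N ≤ k → |u (ns k) x| ≤ M :=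
    ae_all_iff.2 fun k => by
      by_cases hk : N ≤ k
      · filter_upwards [hN k hk] with x hx _ using hx
      · exact Eventually.of_forall fun x h => absurd h hk
  filter_upwards [hae, hN'] with x hx hb
  exact le_of_tendsto hx.abs (eventually_atTop.2 ⟨N, fun k hk => hb k hk⟩)

namespace Problem

variable {n : ℕ} (P : Problem n)

/-- The Newton remainder of the superposition operator `φ`. -/
theorem norm_phi_remainder_le {M C : ℝ} (hφ : ∀ a b : ℝ, |a| ≤ M → |b| ≤ M →
      |P.φ a - P.φ b - deriv P.φ b * (a - b)| ≤ C * (a - b) ^ 2)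
    {x z : P.Bdd} (hx : x.BoundedBy M) (hz : z.BoundedBy M) {qy : Lp ℝ 2 (dom P.Ω)}
    (hqy : qy =ᵐ[dom P.Ω] fun t => embed P.Ω (z.y - x.y) t ^ 2) :
    ‖P.toL2 z.phiY - P.toL2 x.phiY - mulL x.dphiY (embed P.Ω (z.y - x.y))‖ ≤ C * ‖qy‖ := by
  refine Lp.norm_le_mul_norm_of_ae_le_mul ?_
  filter_upwards [Lp.coeFn_sub (P.toL2 z.phiY - P.toL2 x.phiY)
    (mulL x.dphiY (embed P.Ω (z.y - x.y))), Lp.coeFn_sub (P.toL2 z.phiY) (P.toL2 x.phiY),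
    P.toL2_ae z.phiY, P.toL2_ae x.phiY, z.phiY_ae, x.phiY_ae, embed_sub_ae z.y x.y, hx, hz,
    mulL_ae x.dphiY (embed P.Ω (z.y - x.y)), x.dphiY_ae, hqy]
    with t a1 a2 a3 a4 a5 a6 a7 a8 a9 a10 a11 a12
  rw [a1, Pi.sub_apply, a2, Pi.sub_apply, a3, a4, a5, a6, a10, a11, a12, a7, norm_pow,
    Real.norm_eq_abs, Real.norm_eq_abs, sq_abs]
  exact (hφ _ _ a9.1 a8.1)

/-- The Newton remainder of the smoothed projection as a superposition operator. -/
theorem norm_proj_remainder_le {ε δ : ℝ} (hε : 0 < ε) (hδ : 0 < δ) {x z : P.Bdd}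
    {B₁ B₂ : Set (EuclideanSpace ℝ (Fin n))}
    (hB₁ : B₁ = {t | 0 < |(-(embed P.Ω z.p t) / P.mu + 1)| ∧
      |(-(embed P.Ω z.p t) / P.mu + 1)| < δ})
    (hB₂ : B₂ = {t | 0 < |(-(embed P.Ω z.p t) / P.mu - 1)| ∧
      |(-(embed P.Ω z.p t) / P.mu - 1)| < δ})
    {qp r₁ r₂ : Lp ℝ 2 (dom P.Ω)}
    (hqp : qp =ᵐ[dom P.Ω] fun t => embed P.Ω (z.p - x.p) t ^ 2)
    (hr₁ : r₁ =ᵐ[dom P.Ω] fun t => |embed P.Ω (z.p - x.p) t| * B₁.indicator 1 t)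
    (hr₂ : r₂ =ᵐ[dom P.Ω] fun t => |embed P.Ω (z.p - x.p) t| * B₂.indicator 1 t) :
    ‖P.toL2 (z.projP 0) - P.toL2 (x.projP ε)
      + (1 / P.mu) • mulL (x.dprojP hε) (embed P.Ω (z.p - x.p))‖ ≤
      3 * √ε * ‖Lp.const 2 (dom P.Ω) (1 : ℝ)‖ + 2 / P.mu * ‖r₁‖ + 2 / P.mu * ‖r₂‖
        + 8 / (δ * P.mu ^ 2) * ‖qp‖ := by
  have hmu := P.mu_pos
  refine norm_le_of_ae_abs_le (by positivity) (by positivity) (by positivity) (by positivity) ?_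
  filter_upwards [Lp.coeFn_add (P.toL2 (z.projP 0) - P.toL2 (x.projP ε))
    ((1 / P.mu) • mulL (x.dprojP hε) (embed P.Ω (z.p - x.p))),
    Lp.coeFn_sub (P.toL2 (z.projP 0)) (P.toL2 (x.projP ε)), P.toL2_ae (z.projP 0),
    P.toL2_ae (x.projP ε), z.projP_ae 0, x.projP_ae ε, embed_sub_ae z.p x.p,
    Lp.coeFn_smul (1 / P.mu) (mulL (x.dprojP hε) (embed P.Ω (z.p - x.p))),
    mulL_ae (x.dprojP hε) (embed P.Ω (z.p - x.p)), x.dprojP_ae hε, hqp, hr₁, hr₂,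
    Lp.coeFn_const (p := 2) (μ := dom P.Ω) (c := (1 : ℝ))]
    with t a1 a2 a3 a4 a5 a6 a7 a8 a9 a10 a11 a12 a13 a14
  have e : -(embed P.Ω z.p t) / P.mu - -(embed P.Ω x.p t) / P.mu =
      -(1 / P.mu * (embed P.Ω z.p t - embed P.Ω x.p t)) := by ring
  have key := abs_smoothProj_remainder_le hε hδ (-(embed P.Ω z.p t) / P.mu)
    (-(embed P.Ω x.p t) / P.mu)
  rw [e, abs_neg, neg_sq, abs_mul, abs_of_pos (one_div_pos.2 hmu)] at key
  have i₁ : {w : ℝ | 0 < |w| ∧ |w| < δ}.indicator (1 : ℝ → ℝ) (-(embed P.Ω z.p t) / P.mu + 1)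
      = B₁.indicator 1 t := by rw [hB₁]; rfl
  have i₂ : {w : ℝ | 0 < |w| ∧ |w| < δ}.indicator (1 : ℝ → ℝ) (-(embed P.Ω z.p t) / P.mu - 1)
      = B₂.indicator 1 t := by rw [hB₂]; rfl
  rw [i₁, i₂] at key
  have p₁ : 0 ≤ B₁.indicator (1 : EuclideanSpace ℝ (Fin n) → ℝ) t :=
    Set.indicator_nonneg (fun _ _ => zero_le_one) t
  have p₂ : 0 ≤ B₂.indicator (1 : EuclideanSpace ℝ (Fin n) → ℝ) t :=
    Set.indicator_nonneg (fun _ _ => zero_le_one) t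
  rw [a1, Pi.add_apply, a2, Pi.sub_apply, a3, a4, a5, a6, a8, Pi.smul_apply, a9, a10,
    a11, a12, a13, a14, a7, smul_eq_mul, Function.const_apply, abs_one, abs_mul, abs_mul,
    abs_abs, abs_of_nonneg p₁, abs_of_nonneg p₂, abs_pow, sq_abs]
  refine (le_of_eq ?_).trans (key.trans_eq ?_)
  · congr 1; ring
  · field_simp

/-- The Newton remainder of `(y, p) ↦ φ'(y) p`. -/
theorem norm_adjoint_remainder_le {M C : ℝ} (hC : 0 ≤ C) (hφ : ∀ a b : ℝ, |a| ≤ M → |b| ≤ M → |deriv P.φ a - deriv P.φ b| ≤ C * |a - b| ∧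
      |deriv P.φ a - deriv P.φ b - deriv (deriv P.φ) b * (a - b)| ≤ C * (a - b) ^ 2)
    {x z : P.Bdd} (hx : x.BoundedBy M) (hz : z.BoundedBy M) {qy : Lp ℝ 2 (dom P.Ω)}
    (hqy : qy =ᵐ[dom P.Ω] fun t => embed P.Ω (z.y - x.y) t ^ 2)
    {qp : Lp ℝ 2 (dom P.Ω)}
    (hqp : qp =ᵐ[dom P.Ω] fun t => embed P.Ω (z.p - x.p) t ^ 2) :
    ‖mulL z.dphiY (embed P.Ω z.p) - mulL x.dphiY (embed P.Ω x.p)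
      - mulL x.ddphiYP (embed P.Ω (z.y - x.y)) - mulL x.dphiY (embed P.Ω (z.p - x.p))‖ ≤
      (C + |M| * C) * ‖qy‖ + C * ‖qp‖ + 0 * ‖qp‖ + 0 * ‖qp‖ := by
  refine norm_le_of_ae_abs_le (by positivity) hC le_rfl le_rfl ?_
  filter_upwards [Lp.coeFn_sub (mulL z.dphiY (embed P.Ω z.p) - mulL x.dphiY (embed P.Ω x.p)
      - mulL x.ddphiYP (embed P.Ω (z.y - x.y))) (mulL x.dphiY (embed P.Ω (z.p - x.p))),
    Lp.coeFn_sub (mulL z.dphiY (embed P.Ω z.p) - mulL x.dphiY (embed P.Ω x.p))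
      (mulL x.ddphiYP (embed P.Ω (z.y - x.y))),
    Lp.coeFn_sub (mulL z.dphiY (embed P.Ω z.p)) (mulL x.dphiY (embed P.Ω x.p)),
    mulL_ae z.dphiY (embed P.Ω z.p), mulL_ae x.dphiY (embed P.Ω x.p),
    mulL_ae x.ddphiYP (embed P.Ω (z.y - x.y)), mulL_ae x.dphiY (embed P.Ω (z.p - x.p)),
    z.dphiY_ae, x.dphiY_ae, x.ddphiYP_ae, embed_sub_ae z.y x.y, embed_sub_ae z.p x.p, hx, hz,
    hqy, hqp] with t a1 a2 a3 a4 a5 a6 a7 a8 a9 a10 a11 a12 a13 a14 a15 a16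
  rw [a1, Pi.sub_apply, a2, Pi.sub_apply, a3, Pi.sub_apply, a4, a5, a6, a7, a8, a9, a10,
    a15, a16, a11, a12, abs_pow, abs_pow, sq_abs, sq_abs]
  obtain ⟨k1, k2⟩ := hφ _ _ a14.1 a13.1
  have k3 : |embed P.Ω x.p t| ≤ |M| := a13.2.trans (le_abs_self M)
  generalize embed P.Ω z.y t = y₁ at *
  generalize embed P.Ω x.y t = y₀ at *
  generalize embed P.Ω z.p t = p₁ at *
  generalize embed P.Ω x.p t = p₀ at *
  -- A product of two increments plus p₀ times a Taylor remainder: both are quadratic, the second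
  -- because |p₀| ≤ |M|.
  have e : deriv P.φ y₁ * p₁ - deriv P.φ y₀ * p₀ - deriv (deriv P.φ) y₀ * p₀ * (y₁ - y₀)
      - deriv P.φ y₀ * (p₁ - p₀) = (deriv P.φ y₁ - deriv P.φ y₀) * (p₁ - p₀)
      + p₀ * (deriv P.φ y₁ - deriv P.φ y₀ - deriv (deriv P.φ) y₀ * (y₁ - y₀)) := by ring
  rw [e]
  refine (abs_add_le _ _).trans ?_
  rw [abs_mul, abs_mul]
  have k4 : |y₁ - y₀| * |p₁ - p₀| ≤ (y₁ - y₀) ^ 2 + (p₁ - p₀) ^ 2 := by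
    rw [← sq_abs (y₁ - y₀), ← sq_abs (p₁ - p₀)]
    nlinarith [sq_nonneg (|y₁ - y₀| - |p₁ - p₀|), sq_nonneg |y₁ - y₀|, sq_nonneg |p₁ - p₀|]
  calc _ ≤ C * |y₁ - y₀| * |p₁ - p₀| + |M| * (C * (y₁ - y₀) ^ 2) := by gcongr
    _ = C * (|y₁ - y₀| * |p₁ - p₀|) + |M| * (C * (y₁ - y₀) ^ 2) := by ring
    _ ≤ C * ((y₁ - y₀) ^ 2 + (p₁ - p₀) ^ 2) + |M| * (C * (y₁ - y₀) ^ 2) := by gcongr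
    _ = _ := by ring

/-- Newton differentiability along the smoothing path: `∂F/∂x (x, ε) (z - x)` is of order `√ε`
up to a superlinear term in `z - x`. -/
theorem exists_norm_dF_sub_le (hn : n = 2 ∨ n = 3) (M : ℝ) (z : P.Bdd) (hz : z.BoundedBy M)
    (hz0 : P.F z 0 = 0) {η : ℝ} (hη : 0 < η) : ∃ K₀ K : ℝ, ∀ (ε : ℝ) (hε : 0 < ε) (x : P.Bdd),
      x.BoundedBy M → P.F x ε = 0 → ‖P.dF x hε (z.1 - x.1)‖ ≤
        K₀ * √ε + η * ‖z.1 - x.1‖ + K * ‖z.1 - x.1‖ ^ 2 := by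
  obtain ⟨C, hC, hφ⟩ := P.exists_phi_bounds M
  obtain ⟨Kq, hKq, hq⟩ := P.exists_sq hn
  obtain ⟨Ki, hKi, hi⟩ := P.exists_indicator hn
  set one := Lp.const 2 (dom P.Ω) (1 : ℝ)
  have hmu := P.mu_pos
  have hnu := P.nu_pos
  set Kg := ‖gelfand P.Ω‖
  have hKg : 0 ≤ Kg := norm_nonneg (gelfand P.Ω)
  -- G collects the constants in front of τd, with 2/μ from each of the two kinks; the choice of τ
  -- then gives Gτ ≤ η, even when G = 0.
  set G := Kg * (P.mu / P.nu) * (4 / P.mu * Ki)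
  have hG : 0 ≤ G := by positivity
  set τ := η / (G + 1)
  have hτ : 0 < τ := by positivity
  have hGτ : G * τ ≤ η := by
    rw [mul_div_assoc', div_le_iff₀ (by positivity)]; nlinarith
  set s₀ : EuclideanSpace ℝ (Fin n) → ℝ := fun t => -(embed P.Ω z.p t) / P.mu
  have hs₀ : Measurable s₀ := ((Lp.stronglyMeasurable (embed P.Ω z.p)).measurable.neg).div_const _
  -- The measure enters through its cube root, hence the threshold τ³. The resulting δ depends on z
  -- and η only, so K₀ and K are uniform in ε and x.
  have hτ3 : 0 < ENNReal.ofReal (τ ^ 3) := ENNReal.ofReal_pos.2 (by positivity)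
  obtain ⟨δ₁, hδ₁, h₁⟩ := exists_measure_small_ne_zero (μ := dom P.Ω) (hs₀.add_const 1) hτ3
  obtain ⟨δ₂, hδ₂, h₂⟩ := exists_measure_small_ne_zero (μ := dom P.Ω) (hs₀.sub_const 1) hτ3
  set δ := min δ₁ δ₂
  have hδ : 0 < δ := lt_min hδ₁ hδ₂
  set B₁ := {t | 0 < |s₀ t + 1| ∧ |s₀ t + 1| < δ}
  set B₂ := {t | 0 < |s₀ t - 1| ∧ |s₀ t - 1| < δ}
  have hmB : ∀ {f : EuclideanSpace ℝ (Fin n) → ℝ}, Measurable f →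
      MeasurableSet {t | 0 < |f t| ∧ |f t| < δ} := fun hf =>
    (measurableSet_lt measurable_const hf.norm).inter (measurableSet_lt hf.norm measurable_const)
  have hroot : ∀ B : Set (EuclideanSpace ℝ (Fin n)), dom P.Ω B < ENNReal.ofReal (τ ^ 3) →
      (dom P.Ω).real B ^ (1 / 3 : ℝ) ≤ τ := by
    intro B hB
    have h : (dom P.Ω).real B ≤ τ ^ 3 := by
      have := ENNReal.toReal_mono ENNReal.ofReal_ne_top hB.le
      rwa [ENNReal.toReal_ofReal (by positivity)] at this
    calc (dom P.Ω).real B ^ (1 / 3 : ℝ) ≤ (τ ^ 3) ^ (1 / 3 : ℝ) := by gcongr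
      _ = τ := by
        rw [← Real.rpow_natCast, ← Real.rpow_mul hτ.le]; norm_num
  have hB₁ := hroot B₁ (h₁ δ hδ (min_le_left _ _))
  have hB₂ := hroot B₂ (h₂ δ hδ (min_le_right _ _))
  refine ⟨Kg * (P.mu / P.nu) * (3 * ‖one‖), Kg * (C * Kq + P.mu / P.nu * (8 / (δ * P.mu ^ 2) * Kq)
    + ((C + |M| * C) * Kq + C * Kq)), fun ε hε x hx hxF => ?_⟩
  set d := ‖z.1 - x.1‖
  have hr : 0 ≤ √ε := Real.sqrt_nonneg ε
  have hdy : ‖z.y - x.y‖ ≤ d := z.norm_y_sub_le x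
  have hdp : ‖z.p - x.p‖ ≤ d := z.norm_p_sub_le x
  obtain ⟨qy, hqy, nqy⟩ := hq (z.y - x.y)
  obtain ⟨qp, hqp, nqp⟩ := hq (z.p - x.p)
  obtain ⟨r₁, hr₁, nr₁⟩ := hi (z.p - x.p) B₁ (hmB (hs₀.add_const 1))
  obtain ⟨r₂, hr₂, nr₂⟩ := hi (z.p - x.p) B₂ (hmB (hs₀.sub_const 1))
  have nqy' : ‖qy‖ ≤ Kq * d ^ 2 := nqy.trans (by gcongr)
  have nqp' : ‖qp‖ ≤ Kq * d ^ 2 := nqp.trans (by gcongr)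
  have nr₁' : ‖r₁‖ ≤ Ki * d * τ := nr₁.trans (by gcongr)
  have nr₂' : ‖r₂‖ ≤ Ki * d * τ := nr₂.trans (by gcongr)
  set T₁ := P.toL2 z.phiY - P.toL2 x.phiY - mulL x.dphiY (embed P.Ω (z.y - x.y))
  set T₂ := P.toL2 (z.projP 0) - P.toL2 (x.projP ε)
    + (1 / P.mu) • mulL (x.dprojP hε) (embed P.Ω (z.p - x.p))
  set T₃ := mulL z.dphiY (embed P.Ω z.p) - mulL x.dphiY (embed P.Ω x.p)
    - mulL x.ddphiYP (embed P.Ω (z.y - x.y)) - mulL x.dphiY (embed P.Ω (z.p - x.p))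
  have n₁ : ‖T₁‖ ≤ C * ‖qy‖ :=
    P.norm_phi_remainder_le (fun a b ha hb => (hφ a b ha hb).2.2.2.1) hx hz hqy
  have n₂ : ‖T₂‖ ≤ 3 * √ε * ‖one‖ + 2 / P.mu * ‖r₁‖ + 2 / P.mu * ‖r₂‖
      + 8 / (δ * P.mu ^ 2) * ‖qp‖ :=
    P.norm_proj_remainder_le hε hδ rfl rfl hqp hr₁ hr₂
  have n₃ : ‖T₃‖ ≤ (C + |M| * C) * ‖qy‖ + C * ‖qp‖ + 0 * ‖qp‖ + 0 * ‖qp‖ :=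
    P.norm_adjoint_remainder_le hC
      (fun a b ha hb => ⟨(hφ a b ha hb).2.2.1, (hφ a b ha hb).2.2.2.2⟩) hx hz hqy hqp
  rw [P.dF_sub_eq hε x z hxF hz0, norm_neg]
  refine (norm_toLp_le_add _ _).trans ?_
  have hmn : 0 ≤ P.mu / P.nu := by positivity
  calc _ ≤ Kg * (‖T₁‖ + P.mu / P.nu * ‖T₂‖) + Kg * ‖T₃‖ := by
        refine add_le_add (((gelfand P.Ω).le_opNorm _).trans ?_) ((gelfand P.Ω).le_opNorm _)
        gcongr
        refine (norm_add_le _ _).trans_eq ?_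
        rw [norm_smul, Real.norm_of_nonneg hmn]
    _ ≤ Kg * (C * (Kq * d ^ 2) + P.mu / P.nu * (3 * √ε * ‖one‖ + 2 / P.mu * (Ki * d * τ)
          + 2 / P.mu * (Ki * d * τ) + 8 / (δ * P.mu ^ 2) * (Kq * d ^ 2)))
        + Kg * ((C + |M| * C) * (Kq * d ^ 2) + C * (Kq * d ^ 2)) := by
        gcongr
        · exact n₁.trans (by gcongr)
        · exact n₂.trans (by gcongr)
        · refine n₃.trans ?_
          rw [zero_mul, add_zero, add_zero]
          gcongr
    _ = Kg * (P.mu / P.nu) * (3 * ‖one‖) * √ε + (G * τ) * d + Kg * (C * Kq + P.mu / P.nu *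
          (8 / (δ * P.mu ^ 2) * Kq) + ((C + |M| * C) * Kq + C * Kq)) * d ^ 2 := by
        simp only [G]; ring
    _ ≤ _ := by gcongr

end Problem

end EllipticControl


end

/-! ### The convergence rate -/

theorem mainTheorem3 {n : ℕ} (hn : n = 2 ∨ n = 3) (P : EllipticControl.Problem n)
    (x : ℝ → P.Bdd) (hx : ∀ ε : ℝ, 0 < ε → P.F (x ε) ε = 0)
    (hinv : ∃ C : ℝ, ∀ (ε : ℝ) (hε : 0 < ε),
      (P.dF (x ε) hε).IsInvertible ∧ ‖(P.dF (x ε) hε).inverse‖ ≤ C)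
    (xlim : P.V) (hlim : Tendsto (fun ε => (x ε).1) (𝓝[>] (0 : ℝ)) (𝓝 xlim)) :
    (fun ε => ‖xlim - (x ε).1‖) =O[𝓝[>] (0 : ℝ)] (fun ε => Real.sqrt ε) := by
  obtain ⟨C₀, hC₀⟩ := hinv
  have hpos : ∀ᶠ ε in 𝓝[>] (0 : ℝ), 0 < ε := eventually_mem_nhdsWithin
  obtain ⟨M, hM⟩ := P.exists_uniform_bound hn (‖xlim‖ + 1)
  have hbound : ∀ᶠ ε in 𝓝[>] (0 : ℝ), (x ε).BoundedBy M := by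
    filter_upwards [hpos, hlim.norm.eventually (gt_mem_nhds (lt_add_one ‖xlim‖))] with ε hε hn'
    exact hM ε hε.le (x ε) (hx ε hε) hn'.le
  have hyl : Tendsto (fun ε => EllipticControl.embed P.Ω (x ε).y) (𝓝[>] (0 : ℝ))
      (𝓝 (EllipticControl.embed P.Ω xlim.fst)) :=
    (((EllipticControl.embed P.Ω).continuous.comp
      (WithLp.fstL 2 ℝ _ _).continuous).tendsto xlim).comp hlim
  have hpl : Tendsto (fun ε => EllipticControl.embed P.Ω (x ε).p) (𝓝[>] (0 : ℝ))
      (𝓝 (EllipticControl.embed P.Ω xlim.snd)) :=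
    (((EllipticControl.embed P.Ω).continuous.comp
      (WithLp.sndL 2 ℝ _ _).continuous).tendsto xlim).comp hlim
  have hyM := EllipticControl.ae_abs_le_of_tendsto hyl
    (hbound.mono fun ε h => h.mono fun t ht => ht.1)
  have hpM := EllipticControl.ae_abs_le_of_tendsto hpl
    (hbound.mono fun ε h => h.mono fun t ht => ht.2)
  set z : P.Bdd := ⟨xlim, memLp_top_of_bound (Lp.aestronglyMeasurable _) M hyM,
    memLp_top_of_bound (Lp.aestronglyMeasurable _) M hpM⟩
  have hz : z.BoundedBy M := hyM.and hpM
  have hd : Tendsto (fun ε => ‖xlim - (x ε).1‖) (𝓝[>] (0 : ℝ)) (𝓝 0) := by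
    simpa using ((tendsto_const_nhds (x := xlim)).sub hlim).norm
  have hsqrt : Tendsto (fun ε => √ε) (𝓝[>] (0 : ℝ)) (𝓝 0) := by
    have := (Real.continuous_sqrt.tendsto 0).mono_left (nhdsWithin_le_nhds (s := Set.Ioi 0))
    simpa using this
  -- The limit solves the unsmoothed system: F(z, 0) = F(z, 0) - F(x(ε), ε) is bounded by a quantity
  -- tending to 0.
  have hz0 : P.F z 0 = 0 := by
    obtain ⟨C, hC⟩ := P.exists_norm_F_sub_le M
    have h0 : Tendsto (fun ε => C * (‖xlim - (x ε).1‖ + √ε)) (𝓝[>] (0 : ℝ)) (𝓝 0) := by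
      simpa using (hd.add hsqrt).const_mul C
    refine norm_le_zero_iff.1 (ge_of_tendsto h0 ?_)
    filter_upwards [hpos, hbound] with ε hε hb
    have := hC ε hε.le (x ε) z hb hz
    rwa [hx ε hε, sub_zero] at this
  set C := |C₀| + 1
  have hC : 0 < C := by positivity
  -- With η = 1/(4C) the linear term contributes d/4 after inversion, and the quadratic one at most
  -- d/4 once CKd < 1/4. Half of d is absorbed, which leaves the constant 2CK₀.
  obtain ⟨K₀, K, hK⟩ := P.exists_norm_dF_sub_le hn M z hz hz0 (η := 1 / (4 * C)) (by positivity)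
  have hKd : ∀ᶠ ε in 𝓝[>] (0 : ℝ), C * (K * ‖xlim - (x ε).1‖) < 1 / 4 := by
    have : Tendsto (fun ε => C * (K * ‖xlim - (x ε).1‖)) (𝓝[>] (0 : ℝ)) (𝓝 0) := by
      simpa using (hd.const_mul K).const_mul C
    exact this.eventually (gt_mem_nhds (by norm_num))
  refine IsBigO.of_bound (2 * (C * K₀)) ?_
  filter_upwards [hpos, hbound, hKd] with ε hε hb hk
  rw [norm_norm, Real.norm_of_nonneg (Real.sqrt_nonneg ε)]
  have h1 := hK ε hε (x ε) hb (hx ε hε)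
  obtain ⟨hi, hle⟩ := hC₀ ε hε
  have h2 : ‖xlim - (x ε).1‖ ≤ C * ‖P.dF (x ε) hε (xlim - (x ε).1)‖ := by
    have h3 : (P.dF (x ε) hε).inverse (P.dF (x ε) hε (xlim - (x ε).1)) = xlim - (x ε).1 := by
      obtain ⟨e, he⟩ := hi
      rw [← he, ContinuousLinearMap.inverse_equiv]
      exact e.symm_apply_apply _
    have h4 := (P.dF (x ε) hε).inverse.le_opNorm (P.dF (x ε) hε (xlim - (x ε).1))
    rw [h3] at h4
    refine h4.trans ?_
    gcongr
    exact hle.trans ((le_abs_self C₀).trans (by linarith))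
  have h5 : ‖xlim - (x ε).1‖ ≤ C * (K₀ * √ε + 1 / (4 * C) * ‖xlim - (x ε).1‖
      + K * ‖xlim - (x ε).1‖ ^ 2) := h2.trans (by gcongr)
  set D := ‖xlim - (x ε).1‖
  have hD : 0 ≤ D := norm_nonneg _
  have h6 : C * (K₀ * √ε + 1 / (4 * C) * D + K * D ^ 2)
      = C * K₀ * √ε + 1 / 4 * D + C * (K * D) * D := by field_simp
  rw [h6] at h5
  nlinarith
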